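/- **Setting.** Let $n\ge 1$, let $\mathcal A\subset\mathbb R^n$ be non-empty and compact with $\|a\|\le D$ for all $a\in\mathcal A$ ($D>0$, Euclidean norm), and let $\alpha,\beta,\gamma\in(0,1)$, $L>0$, $\bar{\mathcal C}\ge 0$. Let $\mathcal S$ be a state space, $\{P_\theta\}_{\theta\in\Theta}$ a (measurable) family of probability distributions on $\Xi$, $\{\mu_h\}_{h\in\mathbb R^k}$ a family of probability distributions (beliefs) on $\Theta$, $H:\Xi\to\mathbb R^k$, and $\operatorname{Rep}$ a nearest-point map of $\mathbb R^k$ onto a finite grid $\mathcal H^{\rm rep}\subset\mathbb R^k$. Let $\mathcal C:\mathcal S\times\mathcal A\times\Xi\to\mathbb R$ be a cost with $|\mathcal C|\le\bar{\mathcal C}$, $g:\mathcal S\times\mathcal A\times\Xi\to\mathcal S$ a transition map and $V$ a value function with $|V(s,\mu_h)|\le\bar{\mathcal C}/(1-\gamma)$ for $s\in\mathcal S$, $h\in\mathcal H^{\rm rep}$. Fix $h$ and put $$F_s(a,\xi)=\mathcal C(s,a,\xi)+\gamma V(s',\mu_{h'}),\qquad s'=g(s,a,\xi),\quad h'=\operatorname{Rep}(h+H(\xi)),$$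 assumed measurable in $\xi$. With $\mathrm{AVaR}^\beta_P(X)=\frac1\beta\int_{1-\beta}^1F_{X}^{\leftarrow}(t)\,dt$, where $F_X^{\leftarrow}$ is the left quantile function of $X$ under $P$, define the true optimal value $$\vartheta^{\alpha,\beta}_{CC}=\inf_{a\in\mathcal A,\,u\in\mathbb R}\Big\{u+\frac1\alpha\,\mathbb E_{\theta\sim\mu_h}\big[\mathrm{AVaR}^\beta_{P_\theta}(F_s(a,\xi))-u\big]^+\Big\}.$$ Let $\theta_1,\dots,\theta_N$ be i.i.d. with law $\mu_h$ and, given these, let $\xi^{i,j}$ ($1\le i\le N$, $1\le j\le M$) be independent with $\xi^{i,j}\sim P_{\theta_i}$. Let $\vartheta^{N,M,\alpha,\beta}_{CC}$ be the optimal value of the nested sample average approximation $$\min_{u\in\mathbb R,\,a\in\mathcal A,\,v,w\in\mathbb R^N}\ u+\frac1{\alpha N}\sum_{i=1}^N v_i\quad\text{s.t.}\quad v_i\ge w_i+\frac1{\beta M}\sum_{j=1}^M\big[F_s(a,\xi^{i,j})-w_i\big]^+-u,\quad v_i\ge0,\quad i=1,\dots,N.$$ **Theorem.** Suppose that (i)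 $|F_s(a_1,\xi)-F_s(a_2,\xi)|\le L\|a_1-a_2\|$ for all $s\in\mathcal S$, $a_1,a_2\in\mathcal A$, $\xi\in\Xi$; (ii) there is a measurable $\varphi:\Xi\to[0,\infty)$ with $|F_s(a_1,\xi)-F_s(a_2,\xi)|\le\varphi(\xi)\|a_1-a_2\|$ for all $s,a_1,a_2,\xi$; and (iii) for every $\theta$, the moment generating function of $\varphi(\xi)$ under $P_\theta$ is finite in a neighbourhood of $0$. Then there are positive constants $K$ (the "$O(1)$"), $\varsigma$ and $\upsilon$, which can be chosen depending only on $(\alpha,\beta,\gamma,L,D,\bar{\mathcal C})$, such that for all $\eta,\epsilon,\delta>0$ and $\varepsilon'\in(0,1)$, with $$N_0=\Big(\frac{KLD}{\eta}\Big)^2\Big[n\log\frac{KLD}{\eta}+\log\frac1\epsilon\Big],\qquad M_0=\frac{8\varsigma^2}{\delta^2}\Big[\log\Big(1+\frac{D^n\,2\bar{\mathcal C}}{\upsilon^{n+1}(1-\gamma)}\Big)+\log\frac1{\varepsilon'}\Big],$$ for all integers $N\ge1$ and $M\ge1$ with $N\ge N_0$ and $M\ge M_0$, and every $s\in\mathcal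 S$, $$\mathbb P\Big(\vartheta^{N,M,\alpha,\beta}_{CC}-\delta-L\eta\ \le\ \vartheta^{\alpha,\beta}_{CC}\ \le\ \vartheta^{N,M,\alpha,\beta}_{CC}+\delta+L\eta\Big)\ \ge\ 1-\epsilon-2\varepsilon'.$$ -/

import Mathlib

open MeasureTheory ProbabilityTheory

noncomputable section

/-- The left quantile function `t ↦ inf {x : F(x) ≥ t}` of a probability measure on `ℝ`,
where `F` is its cumulative distribution function. -/
def leftQuantile (ν : Measure ℝ) (t : ℝ) : ℝ :=
  sInf {x : ℝ | t ≤ cdf ν x}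

/-- Average value-at-risk at level `α` of the loss `X` under `P`:
`(1/α) ∫_{1-α}^1 F^←(t) dt`, with `F^←` the left quantile function of the law of `X`. -/
def AVaR {Ω : Type*} [MeasurableSpace Ω] (α : ℝ) (P : Measure Ω) (X : Ω → ℝ) : ℝ :=
  (1 / α) * ∫ t in (1 - α)..1, leftQuantile (P.map X) t

/-- `Rep` sends every hyper-parameter to a nearest point (in Euclidean norm) of the finite grid of
representative hyper-parameters. -/
def IsNearestPointMap {k : ℕ} (grid : Finset (EuclideanSpace ℝ (Fin k)))
    (Rep : EuclideanSpace ℝ (Fin k) → EuclideanSpace ℝ (Fin k)) : Prop :=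
  ∀ x, Rep x ∈ grid ∧ ∀ y ∈ grid, ‖x - Rep x‖ ≤ ‖x - y‖

/-- The random cost `C(s,a,ξ) + γ V(s', μ_{h'})` of one stage, where `s' = g(s,a,ξ)` and
`h' = Rep(h + H(ξ))`; `belief h` is the distribution `μ_h` on the parameter space. -/
def stageCost {n k : ℕ} {S Ξ Θ : Type*} [MeasurableSpace Θ] (γ : ℝ)
    (C : S → EuclideanSpace ℝ (Fin n) → Ξ → ℝ)
    (g : S → EuclideanSpace ℝ (Fin n) → Ξ → S)
    (belief : EuclideanSpace ℝ (Fin k) → ProbabilityMeasure Θ)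
    (H : Ξ → EuclideanSpace ℝ (Fin k))
    (Rep : EuclideanSpace ℝ (Fin k) → EuclideanSpace ℝ (Fin k))
    (V : S → ProbabilityMeasure Θ → ℝ)
    (h : EuclideanSpace ℝ (Fin k)) (s : S) (a : EuclideanSpace ℝ (Fin n)) (ξ : Ξ) : ℝ :=
  C s a ξ + γ * V (g s a ξ) (belief (Rep (h + H ξ)))

/-- Optimal value of the Rockafellar-Uryasev form of the AVaR-AVaR problem
`min_{a ∈ A, u ∈ ℝ} u + (1/α) E_{θ ∼ μ} [AVaR^β_{P_θ}(F(a,ξ)) - u]^+`. -/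
def trueValue {E Ξ Θ : Type*} [MeasurableSpace Ξ] [MeasurableSpace Θ]
    (α β : ℝ) (A : Set E) (F : E → Ξ → ℝ) (μ : Measure Θ) (P : Kernel Θ Ξ) : ℝ :=
  sInf {r : ℝ | ∃ a ∈ A, ∃ u : ℝ,
    r = u + (1 / α) * ∫ θ, max (AVaR β (P θ) (F a) - u) 0 ∂μ}

/-- Optimal value of the nested sample average approximation with data `ξ i j`:
minimize `u + (1/(αN)) ∑ i, v i` over `u ∈ ℝ`, `a ∈ A`, `v, w ∈ ℝ^N` subject to
`v i ≥ w i + (1/(βM)) ∑ j, [F(a, ξ i j) - w i]^+ - u` and `v i ≥ 0`. -/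
def nestedSAAValue {E Ξ : Type*} (α β : ℝ) (A : Set E) (F : E → Ξ → ℝ) {N M : ℕ}
    (ξ : Fin N → Fin M → Ξ) : ℝ :=
  sInf {r : ℝ | ∃ u : ℝ, ∃ a ∈ A, ∃ v w : Fin N → ℝ,
    (∀ i, w i + (1 / (β * M)) * ∑ j, max (F a (ξ i j) - w i) 0 - u ≤ v i) ∧
    (∀ i, 0 ≤ v i) ∧
    r = u + (1 / (α * N)) * ∑ i, v i}

/-- Two-level sampling: `θ 1, …, θ N` are i.i.d. with law `μ`, and, given the `θ i`, the variables
`ξ i j` are independent with `ξ i j` of law `P (θ i)`. The joint law is described by its values on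
measurable rectangles, which determine it. -/
def IsNestedSample {Ω Ξ Θ : Type*} [MeasurableSpace Ω] [MeasurableSpace Ξ] [MeasurableSpace Θ]
    (Pr : Measure Ω) (μ : Measure Θ) (P : Kernel Θ Ξ) {N M : ℕ}
    (θ : Fin N → Ω → Θ) (ξ : Fin N → Fin M → Ω → Ξ) : Prop :=
  (∀ i, Measurable (θ i)) ∧ (∀ i j, Measurable (ξ i j)) ∧
  ∀ (A : Fin N → Set Θ) (B : Fin N → Fin M → Set Ξ),
    (∀ i, MeasurableSet (A i)) → (∀ i j, MeasurableSet (B i j)) →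
    Pr {ω | ∀ i, θ i ω ∈ A i ∧ ∀ j, ξ i j ω ∈ B i j} =
      ∏ i, ∫⁻ t in A i, ∏ j, P t (B i j) ∂μ

/-- `N₀ = (K L D / η)² [n log (K L D / η) + log (1/ε)]`, where `K` is the constant `O(1)`. -/
def outerSampleSize (K L D η ε : ℝ) (n : ℕ) : ℝ :=
  (K * L * D / η) ^ 2 * (n * Real.log (K * L * D / η) + Real.log (1 / ε))

/-- `M₀ = (8 σ² / δ²) [log (1 + D^n · 2 C̄ / (υ^{n+1} (1 - γ))) + log (1/ε')]`. -/
def innerSampleSize (σ υ D Cbar γ δ ε' : ℝ) (n : ℕ) : ℝ :=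
  8 * σ ^ 2 / δ ^ 2 *
    (Real.log (1 + D ^ n * (2 * Cbar) / (υ ^ (n + 1) * (1 - γ))) + Real.log (1 / ε'))

end

/-! By the Rockafellar-Uryasev formula, AVaR is the minimum over w of w + (1/β) E[X - w]^+, so both
optimal values are infima of nested positive-part averages. They differ by at most δ + Lη once two
families of empirical deviations are small, uniformly in the action and the thresholds
(`abs_nestedSAAValue_sub_trueValue_le`): the inner ones, of [F(a,·) - w_i]^+ under P_{θ_i}, averaged
over the rows i, must be at most αβδ, and the outer ones, of [AVaR(F(a)) - u]^+ under μ_h, at most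
αLη.

AVaR is nonexpansive for the sup norm, so both families have the same shape: shifted positive parts
of functions bounded by B = C̄/(1-γ) and L-Lipschitz in a. Clamping thresholds to [-B, B] leaves a
bounded index set of dimension n + 1. Since M₀ contains no log(1/δ), a union bound over one fine net
is too expensive. Chaining over dyadic scales (`exists_chaining_bound`, `exists_posPart_bound`)
bounds the λ-exponential moment of the largest deviation over m draws by exp(7(n+1) + 32λ²R²/m) with
R = 4(B + LD). It does so through a measurable majorant, so the supremum itself never has to be
measurable. Markov's inequality with the best λ gives the tails.

M₀ does not contain N either, so a union bound over rows is also excluded. Jensen's inequality for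
exp and linearity of expectation reduce the row average to the moment bound for one row. It remains
to choose K, ς, υ independently of n so that the required sizes lie below N₀ and M₀; when Lη ≥ 2B,
C̄ = 0 or ε ≥ 1 the claim is trivial. -/

section Nets

/-! ### Covering numbers of bounded sets by volume comparison. -/

open Module Metric

variable {E : Type*} [NormedAddCommGroup E] [NormedSpace ℝ E] [FiniteDimensional ℝ E]

/-- An `r`-separated subset of a ball of radius `D` has at most `(1 + 2 D / r) ^ dim` elements. -/
theorem card_le_of_separated_of_norm_le (s : Finset E) {D r : ℝ} (hr : 0 < r) (hD : 0 ≤ D)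
    (hs : ∀ c ∈ s, ‖c‖ ≤ D) (h : ∀ c ∈ s, ∀ d ∈ s, c ≠ d → r ≤ ‖c - d‖) :
    (s.card : ℝ) ≤ (1 + 2 * D / r) ^ finrank ℝ E := by
  borelize E
  let μ : Measure E := Measure.addHaar
  have hr2 : 0 < r / 2 := half_pos hr
  have hρ : 0 < r / 2 + D := by positivity
  have hdisj : Set.Pairwise (s : Set E) (Function.onFun Disjoint fun c => ball (c : E) (r / 2)) := by
    rintro c hc d hd hcd
    apply ball_disjoint_ball
    rw [dist_eq_norm]
    linarith [h c hc d hd hcd]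
  have hsub : (⋃ c ∈ s, ball (c : E) (r / 2)) ⊆ ball (0 : E) (r / 2 + D) := by
    refine Set.iUnion₂_subset fun x hx => ball_subset_ball' ?_
    rw [dist_zero_right]
    exact add_le_add le_rfl (hs x hx)
  have hvol : (s.card : ENNReal) * ENNReal.ofReal ((r / 2) ^ finrank ℝ E) * μ (ball 0 1) ≤
      ENNReal.ofReal ((r / 2 + D) ^ finrank ℝ E) * μ (ball 0 1) :=
    calc
      (s.card : ENNReal) * ENNReal.ofReal ((r / 2) ^ finrank ℝ E) * μ (ball 0 1)
          = μ (⋃ c ∈ s, ball (c : E) (r / 2)) := by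
        rw [measure_biUnion_finset hdisj fun c _ => measurableSet_ball]
        simp only [μ.addHaar_ball_of_pos _ hr2]
        simp only [Finset.sum_const, nsmul_eq_mul, mul_assoc]
      _ ≤ μ (ball (0 : E) (r / 2 + D)) := measure_mono hsub
      _ = ENNReal.ofReal ((r / 2 + D) ^ finrank ℝ E) * μ (ball 0 1) := by
        simp only [μ.addHaar_ball_of_pos _ hρ]
  have hcard : (s.card : ENNReal) * ENNReal.ofReal ((r / 2) ^ finrank ℝ E) ≤
      ENNReal.ofReal ((r / 2 + D) ^ finrank ℝ E) :=
    (ENNReal.mul_le_mul_iff_left (measure_ball_pos _ _ zero_lt_one).ne' measure_ball_lt_top.ne).1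
      hvol
  have hreal : (s.card : ℝ) * (r / 2) ^ finrank ℝ E ≤ (r / 2 + D) ^ finrank ℝ E := by
    have := ENNReal.toReal_le_of_le_ofReal (by positivity) hcard
    rwa [ENNReal.toReal_mul, ENNReal.toReal_ofReal (by positivity), ENNReal.toReal_natCast] at this
  have hsplit : (r / 2 + D) = (1 + 2 * D / r) * (r / 2) := by field_simp
  rw [hsplit, mul_pow] at hreal
  exact le_of_mul_le_mul_right hreal (by positivity)

/-- A subset of a ball of radius `D` has an internal `r`-net with at most `(1 + 2 D / r) ^ dim`
elements. -/
theorem exists_finset_net (s : Set E) {D r : ℝ} (hr : 0 < r) (hD : 0 ≤ D)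
    (hs : ∀ c ∈ s, ‖c‖ ≤ D) :
    ∃ t : Finset E, (∀ y ∈ t, y ∈ s) ∧ (t.card : ℝ) ≤ (1 + 2 * D / r) ^ finrank ℝ E ∧
      ∀ x ∈ s, ∃ y ∈ t, ‖x - y‖ ≤ r := by
  classical
  by_contra! hcon
  -- If no small net exists, a separated set can always be enlarged by a point far from it: the
  -- volume bound keeps its cardinality admissible, so it is never a net. Separated sets of every
  -- size would then exist, against the same volume bound.
  have key : ∀ m : ℕ, ∃ t : Finset E, (∀ y ∈ t, y ∈ s) ∧ t.card = m ∧
      ∀ c ∈ t, ∀ d ∈ t, c ≠ d → r ≤ ‖c - d‖ := by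
    intro m
    induction m with
    | zero => exact ⟨∅, by simp⟩
    | succ m ih =>
      obtain ⟨t, hts, htm, hsep⟩ := ih
      obtain ⟨x, hx, hfar⟩ := hcon t hts
        (card_le_of_separated_of_norm_le t hr hD (fun c hc => hs c (hts c hc)) hsep)
      have hxt : x ∉ t := fun h => by
        have := hfar x h
        simp only [sub_self, norm_zero] at this
        linarith
      refine ⟨insert x t, ?_, by rw [Finset.card_insert_of_notMem hxt, htm], ?_⟩
      · intro y hy
        rcases Finset.mem_insert.1 hy with rfl | hy
        exacts [hx, hts y hy]
      · intro c hc d hd hcd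
        rcases Finset.mem_insert.1 hc with rfl | hct <;>
          rcases Finset.mem_insert.1 hd with rfl | hdt
        · exact absurd rfl hcd
        · exact (hfar d hdt).le
        · rw [norm_sub_rev]
          exact (hfar c hct).le
        · exact hsep c hct d hdt hcd
  obtain ⟨m, hm⟩ := exists_nat_gt ((1 + 2 * D / r) ^ finrank ℝ E)
  obtain ⟨t, hts, htm, hsep⟩ := key m
  have := card_le_of_separated_of_norm_le t hr hD (fun c hc => hs c (hts c hc)) hsep
  rw [htm] at this
  linarith

end Nets

/-! ### Left quantiles and the quantile transform. -/

section Quantile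

open Set

variable {ν : Measure ℝ}

/-- Right continuity of the cdf makes the infimum attained. The restriction 0 < t < 1 keeps the
defining set nonempty and bounded below, so that `sInf` is not a default value. -/
theorem leftQuantile_le_iff {t : ℝ} (ht : t ∈ Ioo (0 : ℝ) 1) (x : ℝ) :
    leftQuantile ν t ≤ x ↔ t ≤ cdf ν x := by
  have hbdd : BddBelow {x : ℝ | t ≤ cdf ν x} := by
    obtain ⟨b, hb⟩ := ((tendsto_cdf_atBot ν).eventually (gt_mem_nhds ht.1)).exists
    refine ⟨b, fun y (hy : t ≤ cdf ν y) => ?_⟩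
    by_contra! hlt
    exact absurd (hy.trans (monotone_cdf ν hlt.le)) (not_le.2 hb)
  have hne : {x : ℝ | t ≤ cdf ν x}.Nonempty := by
    obtain ⟨b, hb⟩ := ((tendsto_cdf_atTop ν).eventually (lt_mem_nhds ht.2)).exists
    exact ⟨b, hb.le⟩
  refine ⟨fun h => ?_, fun h => csInf_le hbdd h⟩
  have hright : Filter.Tendsto (cdf ν) (nhdsWithin x (Ioi x)) (nhds (cdf ν x)) :=
    ((cdf ν).right_continuous x).tendsto.mono_left (nhdsWithin_mono _ Ioi_subset_Ici_self)
  refine ge_of_tendsto hright ?_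
  filter_upwards [self_mem_nhdsWithin] with y hy
  obtain ⟨z, hz, hzy⟩ := exists_lt_of_csInf_lt hne (lt_of_le_of_lt h hy)
  exact le_trans hz (monotone_cdf ν hzy.le)

theorem monotoneOn_leftQuantile : MonotoneOn (leftQuantile ν) (Ioo 0 1) := by
  intro s hs t ht hst
  rw [leftQuantile_le_iff hs]
  exact hst.trans ((leftQuantile_le_iff ht _).1 le_rfl)

theorem aemeasurable_leftQuantile :
    AEMeasurable (leftQuantile ν) (volume.restrict (Ioo (0 : ℝ) 1)) :=
  aemeasurable_restrict_of_monotoneOn measurableSet_Ioo monotoneOn_leftQuantile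

/-- The quantile transform: the left quantile function pushes the uniform law on `(0, 1)` to `ν`. -/
theorem map_leftQuantile [IsProbabilityMeasure ν] :
    (volume.restrict (Ioo (0 : ℝ) 1)).map (leftQuantile ν) = ν := by
  have : IsFiniteMeasure ((volume.restrict (Ioo (0 : ℝ) 1)).map (leftQuantile ν)) :=
    ⟨by rw [Measure.map_apply_of_aemeasurable aemeasurable_leftQuantile .univ]; simp⟩
  refine Measure.ext_of_Iic _ _ fun x => ?_
  rw [Measure.map_apply_of_aemeasurable aemeasurable_leftQuantile measurableSet_Iic,
    Measure.restrict_apply' measurableSet_Ioo, ← ofReal_cdf ν x]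
  have hset : leftQuantile ν ⁻¹' Iic x ∩ Ioo 0 1 = Iic (cdf ν x) ∩ Ioo 0 1 := by
    ext t
    simp only [mem_inter_iff, mem_preimage, mem_Iic]
    exact and_congr_left fun ht => leftQuantile_le_iff ht x
  rw [hset]
  apply le_antisymm
  · calc volume (Iic (cdf ν x) ∩ Ioo 0 1) ≤ volume (Icc 0 (cdf ν x)) :=
        measure_mono fun t ht => ⟨ht.2.1.le, ht.1⟩
      _ = ENNReal.ofReal (cdf ν x) := by simp
  · calc ENNReal.ofReal (cdf ν x) = volume (Ioo 0 (cdf ν x)) := by simp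
      _ ≤ volume (Iic (cdf ν x) ∩ Ioo 0 1) :=
        measure_mono fun t ht => ⟨ht.2.le, ht.1, ht.2.trans_le (cdf_le_one ν x)⟩

theorem abs_leftQuantile_le [IsProbabilityMeasure ν] {B : ℝ} (hν : ∀ᵐ x ∂ν, |x| ≤ B) {t : ℝ}
    (ht : t ∈ Ioo (0 : ℝ) 1) : |leftQuantile ν t| ≤ B := by
  rw [abs_le]
  constructor
  · by_contra! hlt
    have h1 := (leftQuantile_le_iff (ν := ν) ht _).1 le_rfl
    have h2 : cdf ν (leftQuantile ν t) = 0 := by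
      rw [cdf_eq_real, measureReal_eq_zero_iff]
      refine measure_mono_null (fun x hx => ?_) (ae_iff.1 hν)
      intro hx'
      have hx2 : x ≤ leftQuantile ν t := hx
      linarith [(abs_le.1 hx').1]
    linarith [ht.1]
  · rw [leftQuantile_le_iff ht]
    have h2 : cdf ν B = 1 := by
      have : ν (Iic B) = 1 :=
        (prob_compl_eq_zero_iff measurableSet_Iic).1 (mem_ae_iff.1 (hν.mono fun x hx => (abs_le.1 hx).2))
      rw [cdf_eq_real, measureReal_def, this, ENNReal.toReal_one]
    rw [h2]
    exact ht.2.le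

end Quantile

/-! ### The variational formula for AVaR and its consequences. -/

section RockafellarUryasev

open Set

variable {Ω : Type*} [MeasurableSpace Ω] {P : Measure Ω} [IsProbabilityMeasure P]
  {X Y : Ω → ℝ} {B β : ℝ}

theorem integrable_posPart_sub (hX : Measurable X) (hB : ∀ ω, |X ω| ≤ B) (w : ℝ) :
    Integrable (fun ω => max (X ω - w) 0) P := by
  refine Integrable.of_mem_Icc 0 (B + |w|) (by fun_prop) (.of_forall fun ω => ⟨le_max_right _ _, ?_⟩)
  have h1 := hB ω
  have h2 := abs_nonneg (X ω)
  exact max_le (by linarith [le_abs_self (X ω), neg_abs_le w]) (by linarith [abs_nonneg w])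

theorem integral_posPart_eq_quantile (hX : Measurable X) (w : ℝ) :
    ∫ ω, max (X ω - w) 0 ∂P = ∫ t in Ioo (0 : ℝ) 1, max (leftQuantile (P.map X) t - w) 0 := by
  have := Measure.isProbabilityMeasure_map (μ := P) hX.aemeasurable
  have h1 : ∫ ω, max (X ω - w) 0 ∂P = ∫ x, max (x - w) 0 ∂(P.map X) :=
    (integral_map (f := fun x => max (x - w) 0) hX.aemeasurable
      (Measurable.aestronglyMeasurable (by fun_prop))).symm
  rw [h1]
  conv_lhs => rw [← map_leftQuantile (ν := P.map X)]
  rw [integral_map aemeasurable_leftQuantile (Measurable.aestronglyMeasurable (by fun_prop))]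

/-- The Rockafellar-Uryasev objective. -/
noncomputable def ruObjective (β : ℝ) (P : Measure Ω) (X : Ω → ℝ) (w : ℝ) : ℝ :=
  w + (1 / β) * ∫ ω, max (X ω - w) 0 ∂P

theorem AVaR_eq_setIntegral {Ω : Type*} [MeasurableSpace Ω] {P : Measure Ω} {X : Ω → ℝ} {β : ℝ}
    (hβ : β ∈ Ioo (0 : ℝ) 1) :
    AVaR β P X = (1 / β) * ∫ t in Ioo (1 - β) 1, leftQuantile (P.map X) t := by
  rw [AVaR, intervalIntegral.integral_of_le (by linarith [hβ.1]), integral_Ioc_eq_integral_Ioo]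

theorem map_ae_abs_le {Ω : Type*} [MeasurableSpace Ω] {P : Measure Ω} {X : Ω → ℝ} {B : ℝ}
    (hX : Measurable X) (hB : ∀ ω, |X ω| ≤ B) : ∀ᵐ x ∂(P.map X), |x| ≤ B :=
  (ae_map_iff hX.aemeasurable (measurableSet_le (by fun_prop) (by fun_prop))).2 (.of_forall hB)

theorem integrableOn_leftQuantile (hX : Measurable X) (hB : ∀ ω, |X ω| ≤ B) :
    IntegrableOn (leftQuantile (P.map X)) (Ioo 0 1) := by
  have := Measure.isProbabilityMeasure_map (μ := P) hX.aemeasurable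
  refine Integrable.of_mem_Icc (-B) B aemeasurable_leftQuantile ?_
  filter_upwards [ae_restrict_mem measurableSet_Ioo] with t ht
  exact abs_le.1 (abs_leftQuantile_le (map_ae_abs_le hX hB) ht)

/-- In quantile form, dropping the positive part and shrinking (0,1) to (1-β,1) can only decrease
the integral; what remains is β(AVaR - w). -/
theorem AVaR_le_ruObjective (hβ : β ∈ Ioo (0 : ℝ) 1) (hX : Measurable X) (hB : ∀ ω, |X ω| ≤ B)
    (w : ℝ) : AVaR β P X ≤ ruObjective β P X w := by
  rw [AVaR_eq_setIntegral hβ, ruObjective, integral_posPart_eq_quantile hX]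
  have hsub : Ioo (1 - β) 1 ⊆ Ioo (0 : ℝ) 1 := Ioo_subset_Ioo_left (by linarith [hβ.2])
  have hq := integrableOn_leftQuantile (P := P) hX hB
  have hqw : IntegrableOn (fun t => leftQuantile (P.map X) t - w) (Ioo (0 : ℝ) 1) :=
    Integrable.sub hq (integrable_const w)
  have hpos : IntegrableOn (fun t => max (leftQuantile (P.map X) t - w) 0) (Ioo (0 : ℝ) 1) :=
    hqw.pos_part
  have h1 : ∫ t in Ioo (1 - β) 1, (leftQuantile (P.map X) t - w)
      ≤ ∫ t in Ioo (0 : ℝ) 1, max (leftQuantile (P.map X) t - w) 0 :=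
    (setIntegral_mono (hqw.mono_set hsub) (hpos.mono_set hsub) fun t => le_max_left _ _).trans
      (setIntegral_mono_set hpos (.of_forall fun t => le_max_right _ _) hsub.eventuallyLE)
  rw [integral_sub (hq.mono_set hsub) (integrable_const w)] at h1
  simp only [integral_const, measureReal_restrict_apply_univ, Real.volume_real_Ioo, smul_eq_mul] at h1
  rw [show (1 : ℝ) - (1 - β) = β by ring, max_eq_left hβ.1.le] at h1
  have hw : w = 1 / β * (β * w) := by field_simp [hβ.1.ne']
  rw [← sub_le_iff_le_add']
  calc _ = 1 / β * ((∫ t in Ioo (1 - β) 1, leftQuantile (P.map X) t) - β * w) := by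
        rw [mul_sub, ← hw]
    _ ≤ _ := mul_le_mul_of_nonneg_left h1 (one_div_nonneg.2 hβ.1.le)

/-- The minimiser is the (1-β)-quantile: by monotonicity, the positive part is then supported
exactly on the tail (1-β,1), so nothing is lost. -/
theorem exists_ruObjective_eq_AVaR (hβ : β ∈ Ioo (0 : ℝ) 1) (hX : Measurable X)
    (hB : ∀ ω, |X ω| ≤ B) : ∃ w, |w| ≤ B ∧ ruObjective β P X w = AVaR β P X := by
  have := Measure.isProbabilityMeasure_map (μ := P) hX.aemeasurable
  have hmem : 1 - β ∈ Ioo (0 : ℝ) 1 := ⟨by linarith [hβ.2], by linarith [hβ.1]⟩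
  set q := leftQuantile (P.map X) with hqdef
  refine ⟨q (1 - β), abs_leftQuantile_le (map_ae_abs_le hX hB) hmem, ?_⟩
  rw [AVaR_eq_setIntegral hβ, ruObjective, integral_posPart_eq_quantile hX]
  have hsub : Ioo (1 - β) 1 ⊆ Ioo (0 : ℝ) 1 := Ioo_subset_Ioo_left (by linarith [hβ.2])
  have hq : IntegrableOn q (Ioo 0 1) := integrableOn_leftQuantile (P := P) hX hB
  have h1 : ∫ t in Ioo (0 : ℝ) 1, max (q t - q (1 - β)) 0
      = ∫ t in Ioo (1 - β) 1, (q t - q (1 - β)) := by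
    rw [setIntegral_eq_of_subset_of_forall_sdiff_eq_zero measurableSet_Ioo hsub]
    · refine setIntegral_congr_fun measurableSet_Ioo fun t ht => max_eq_left (sub_nonneg.2 ?_)
      exact monotoneOn_leftQuantile hmem (hsub ht) ht.1.le
    · intro t ht
      refine max_eq_right (sub_nonpos.2 (monotoneOn_leftQuantile ht.1 hmem ?_))
      by_contra! hlt
      exact ht.2 ⟨hlt, ht.1.2⟩
  rw [h1, integral_sub (hq.mono_set hsub) (integrable_const _)]
  simp only [integral_const, measureReal_restrict_apply_univ, Real.volume_real_Ioo, smul_eq_mul]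
  rw [show (1 : ℝ) - (1 - β) = β by ring, max_eq_left hβ.1.le]
  field_simp [hβ.1.ne']
  ring

/-- Shift the minimiser for Y by c and use it as a trial point for X. -/
theorem AVaR_le_AVaR_add (hβ : β ∈ Ioo (0 : ℝ) 1) (hX : Measurable X) (hB : ∀ ω, |X ω| ≤ B)
    (hY : Measurable Y) (hYB : ∀ ω, |Y ω| ≤ B) {c : ℝ} (h : ∀ ω, X ω ≤ Y ω + c) :
    AVaR β P X ≤ AVaR β P Y + c := by
  obtain ⟨w, -, hw⟩ := exists_ruObjective_eq_AVaR (P := P) hβ hY hYB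
  refine (AVaR_le_ruObjective hβ hX hB (w + c)).trans ?_
  rw [← hw, ruObjective, ruObjective]
  have : ∫ ω, max (X ω - (w + c)) 0 ∂P ≤ ∫ ω, max (Y ω - w) 0 ∂P :=
    integral_mono (integrable_posPart_sub hX hB _) (integrable_posPart_sub hY hYB _)
      fun ω => max_le_max (by linarith [h ω]) le_rfl
  have := mul_le_mul_of_nonneg_left this (one_div_nonneg.2 hβ.1.le)
  linarith

theorem abs_AVaR_le (hβ : β ∈ Ioo (0 : ℝ) 1) (hX : Measurable X) (hB : ∀ ω, |X ω| ≤ B) :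
    |AVaR β P X| ≤ B := by
  rw [abs_le]
  constructor
  · obtain ⟨w, -, hw⟩ := exists_ruObjective_eq_AVaR (P := P) hβ hX hB
    rw [← hw, ruObjective]
    have h0 : 0 ≤ ∫ ω, max (X ω - w) 0 ∂P := integral_nonneg fun ω => le_max_right _ _
    have h1 : ∫ _, (-B - w) ∂P ≤ ∫ ω, max (X ω - w) 0 ∂P :=
      integral_mono (integrable_const _) (integrable_posPart_sub hX hB _)
        fun ω => le_max_of_le_left (by linarith [(abs_le.1 (hB ω)).1])
    rw [integral_const, probReal_univ, one_smul] at h1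
    have h2 : (1 : ℝ) ≤ 1 / β := by rw [le_div_iff₀ hβ.1]; linarith [hβ.2]
    have := mul_le_mul_of_nonneg_right h2 h0
    linarith
  · refine (AVaR_le_ruObjective hβ hX hB B).trans ?_
    have : ∀ ω, max (X ω - B) 0 = 0 := fun ω => max_eq_right (by linarith [(abs_le.1 (hB ω)).2])
    simp [ruObjective, this]

/-- Nonexpansiveness transfers the Lipschitz constant L from the cost to its AVaR, so the outer
level meets the same hypotheses as the inner one. -/
theorem abs_AVaR_sub_le (hβ : β ∈ Ioo (0 : ℝ) 1) (hX : Measurable X) (hB : ∀ ω, |X ω| ≤ B)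
    (hY : Measurable Y) (hYB : ∀ ω, |Y ω| ≤ B) {c : ℝ} (h : ∀ ω, |X ω - Y ω| ≤ c) :
    |AVaR β P X - AVaR β P Y| ≤ c := by
  rw [abs_sub_le_iff]
  constructor
  · linarith [AVaR_le_AVaR_add (P := P) hβ hX hB hY hYB
      (fun ω => by linarith [(abs_le.1 (h ω)).2] : ∀ ω, X ω ≤ Y ω + c)]
  · linarith [AVaR_le_AVaR_add (P := P) hβ hY hYB hX hB
      (fun ω => by linarith [(abs_le.1 (h ω)).1] : ∀ ω, Y ω ≤ X ω + c)]

theorem continuous_ruObjective (hX : Measurable X) (hB : ∀ ω, |X ω| ≤ B) :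
    Continuous (ruObjective β P X) := by
  have hlip : LipschitzWith 1 fun w => ∫ ω, max (X ω - w) 0 ∂P := by
    refine LipschitzWith.of_dist_le_mul fun w w' => ?_
    rw [Real.dist_eq, ← integral_sub (integrable_posPart_sub hX hB _)
      (integrable_posPart_sub hX hB _)]
    have := norm_integral_le_of_norm_le_const (μ := P) (C := |w - w'|)
      (f := fun ω => max (X ω - w) 0 - max (X ω - w') 0) (.of_forall fun ω => by
        refine (abs_max_sub_max_le_abs _ _ _).trans ?_
        rw [sub_sub_sub_cancel_left, abs_sub_comm])
    simpa [Real.dist_eq] using this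
  unfold ruObjective
  exact continuous_id.add (continuous_const.mul hlip.continuous)

/-- AVaR is a minimum over w of a continuous function, so its strict sublevel sets are countable
unions over rational w of sublevel sets of kernel integrals. -/
theorem measurable_AVaR {Θ : Type*} [MeasurableSpace Θ] (P : Kernel Θ Ω) [IsMarkovKernel P]
    (hβ : β ∈ Ioo (0 : ℝ) 1) (hX : Measurable X) (hB : ∀ ω, |X ω| ≤ B) :
    Measurable fun θ => AVaR β (P θ) X := by
  refine measurable_of_Iio fun c => ?_
  have : (fun θ => AVaR β (P θ) X) ⁻¹' Iio c =
      ⋃ w : ℚ, {θ | ruObjective β (P θ) X w < c} := by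
    ext θ
    simp only [mem_preimage, mem_Iio, mem_iUnion, mem_ofPred_eq]
    constructor
    · intro h
      obtain ⟨w, -, hw⟩ := exists_ruObjective_eq_AVaR (P := P θ) hβ hX hB
      rw [← hw] at h
      have hopen : IsOpen {w | ruObjective β (P θ) X w < c} :=
        isOpen_lt (continuous_ruObjective hX hB) continuous_const
      obtain ⟨r, hr⟩ := Rat.denseRange_cast.exists_mem_open hopen ⟨w, h⟩
      exact ⟨r, hr⟩
    · rintro ⟨w, hw⟩
      exact (AVaR_le_ruObjective hβ hX hB _).trans_lt hw
  rw [this]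
  refine MeasurableSet.iUnion fun w => measurableSet_lt ?_ measurable_const
  unfold ruObjective
  have hm : StronglyMeasurable fun θ => ∫ ω, max (X ω - w) 0 ∂(P θ) :=
    StronglyMeasurable.integral_kernel (Measurable.stronglyMeasurable (by fun_prop))
  exact measurable_const.add (measurable_const.mul hm.measurable)

end RockafellarUryasev

/-! ### Empirical deviations and their Hoeffding bound. -/

section EmpiricalProcess

variable {X : Type*} [MeasurableSpace X] {m : ℕ}

/-- Deviation of the empirical mean of `f` on the sample `x` from its mean under `ν`. -/
noncomputable def empDev (ν : Measure X) (f : X → ℝ) (x : Fin m → X) : ℝ :=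
  (1 / (m : ℝ)) * ∑ j, f (x j) - ∫ y, f y ∂ν

theorem empDev_sub {ν : Measure X} {f g : X → ℝ} (hf : Integrable f ν) (hg : Integrable g ν)
    (x : Fin m → X) : empDev ν (fun y => f y - g y) x = empDev ν f x - empDev ν g x := by
  simp only [empDev, Finset.sum_sub_distrib, integral_sub hf hg]
  ring

theorem abs_empDev_le {ν : Measure X} [IsProbabilityMeasure ν] {g : X → ℝ} {ρ : ℝ}
    (hρ : ∀ y, |g y| ≤ ρ) (x : Fin m → X) : |empDev ν g x| ≤ 2 * ρ := by
  have hρ0 : 0 ≤ ρ := (abs_nonneg _).trans (hρ (nonempty_of_isProbabilityMeasure ν).some)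
  have h1 : |(1 / (m : ℝ)) * ∑ j, g (x j)| ≤ ρ := by
    rcases Nat.eq_zero_or_pos m with rfl | hm
    · simpa using hρ0
    have hm' : (0 : ℝ) < m := by exact_mod_cast hm
    rw [abs_mul, abs_of_pos (one_div_pos.2 hm'), one_div, inv_mul_le_iff₀ hm']
    refine (Finset.abs_sum_le_sum_abs _ _).trans ((Finset.sum_le_sum fun j _ => hρ (x j)).trans ?_)
    simp
  have h2 : |∫ y, g y ∂ν| ≤ ρ := by
    have := norm_integral_le_of_norm_le_const (μ := ν) (f := g) (C := ρ) (.of_forall hρ)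
    simpa using this
  calc |empDev ν g x| ≤ _ := abs_sub _ _
    _ ≤ 2 * ρ := by linarith

/-- Hoeffding's bound for the exponential moments of an empirical deviation. -/
theorem lintegral_exp_mul_empDev_le {ν : Measure X} [IsProbabilityMeasure ν] {g : X → ℝ} {ρ : ℝ}
    (hg : Measurable g) (hρ : ∀ y, |g y| ≤ ρ) (hm : 0 < m) (s : ℝ) :
    ∫⁻ x : Fin m → X, ENNReal.ofReal (Real.exp (s * empDev ν g x)) ∂(Measure.pi fun _ => ν)
      ≤ ENNReal.ofReal (Real.exp (s ^ 2 * ρ ^ 2 / (2 * m))) := by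
  have hm' : (0 : ℝ) < m := by exact_mod_cast hm
  have hρ0 : 0 ≤ ρ := (abs_nonneg _).trans (hρ (nonempty_of_isProbabilityMeasure ν).some)
  have hsub := hasSubgaussianMGF_of_mem_Icc (μ := ν) (X := g) (a := -ρ) (b := ρ) hg.aemeasurable
    (.of_forall fun y => abs_le.1 (hρ y))
  have hexp : ∀ x : Fin m → X, Real.exp (s * empDev ν g x)
      = ∏ j, Real.exp (s / m * (g (x j) - ∫ y, g y ∂ν)) := by
    intro x
    rw [← Real.exp_sum, ← Finset.mul_sum, Finset.sum_sub_distrib, empDev]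
    simp only [Finset.sum_const, Finset.card_univ, Fintype.card_fin, nsmul_eq_mul]
    congr 1
    field_simp
  have hint : Integrable (fun x : Fin m → X => ∏ j, Real.exp (s / m * (g (x j) - ∫ y, g y ∂ν)))
      (Measure.pi fun _ => ν) :=
    Integrable.fintype_prod (f := fun _ y => Real.exp (s / m * (g y - ∫ y, g y ∂ν)))
      fun _ => hsub.integrable_exp_mul _
  simp_rw [hexp]
  rw [← ofReal_integral_eq_lintegral_ofReal hint
    (.of_forall fun x => Finset.prod_nonneg fun j _ => (Real.exp_pos _).le)]
  refine ENNReal.ofReal_le_ofReal ?_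
  rw [integral_fintype_prod_eq_pow (ι := Fin m)
    (fun y => Real.exp (s / m * (g y - ∫ y, g y ∂ν))), Fintype.card_fin]
  -- Range 2ρ gives variance proxy ρ²; m independent factors at parameter s/m multiply to exp(m
  -- (s/m)² ρ²/2).
  have hmgf := hsub.mgf_le (s / m)
  rw [mgf] at hmgf
  refine (pow_le_pow_left₀ (integral_nonneg fun y => (Real.exp_pos _).le) hmgf m).trans ?_
  rw [← Real.exp_nat_mul, Real.exp_le_exp]
  simp only [NNReal.coe_pow, NNReal.coe_div, coe_nnnorm, Real.norm_eq_abs, NNReal.coe_ofNat]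
  rw [show ρ - -ρ = 2 * ρ by ring, abs_of_nonneg (by positivity)]
  apply le_of_eq
  field_simp

theorem measurable_empDev {Θ : Type*} [MeasurableSpace Θ] (P : Kernel Θ X) [IsMarkovKernel P]
    {f : X → ℝ} (hf : Measurable f) :
    Measurable fun q : Θ × (Fin m → X) => empDev (P q.1) f q.2 := by
  have hm : StronglyMeasurable fun θ => ∫ y, f y ∂(P θ) :=
    StronglyMeasurable.integral_kernel hf.stronglyMeasurable
  have hm' := hm.measurable.comp (measurable_fst : Measurable (Prod.fst : Θ × (Fin m → X) → Θ))
  unfold empDev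
  refine Measurable.sub ?_ hm'
  fun_prop

end EmpiricalProcess

/-! ### Chaining for exponential moments. -/

section Chaining

/-- The weights p_k = (3/4)^k/4 divide the exponent among the chaining levels. -/
theorem sum_chainWeight_le (K : ℕ) : ∑ k ∈ Finset.range K, (3 / 4 : ℝ) ^ k / 4 ≤ 1 := by
  have : ∑ k ∈ Finset.range K, (3 / 4 : ℝ) ^ k / 4 = 1 - (3 / 4 : ℝ) ^ K := by
    induction K with
    | zero => simp
    | succ K ih => rw [Finset.sum_range_succ, ih]; ring
  rw [this]
  linarith [pow_nonneg (by norm_num : (0 : ℝ) ≤ 3 / 4) K]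

/-- The factors τ_k = (4/9)^k must beat the net entropy, which grows linearly in k. -/
theorem linear_mul_chainExponent_le (k : ℕ) : (3 * k + 4 : ℝ) * (4 / 9) ^ k ≤ 4 := by
  induction k with
  | zero => norm_num
  | succ k ih =>
    have h : (0 : ℝ) ≤ (4 / 9) ^ k := by positivity
    have hk : (0 : ℝ) ≤ k := k.cast_nonneg
    rw [pow_succ]
    push_cast
    nlinarith [mul_nonneg hk h]

theorem sum_exp_neg_succ_le (K : ℕ) : ∑ k ∈ Finset.range K, Real.exp (-(k + 1 : ℝ)) ≤ 1 := by
  have h1 : ∀ k : ℕ, Real.exp (-(k + 1 : ℝ)) ≤ (1 / 2) ^ (k + 1) := by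
    intro k
    have : Real.exp (-(k + 1 : ℝ)) = Real.exp (-1) ^ (k + 1) := by
      rw [← Real.exp_nat_mul]; push_cast; ring_nf
    rw [this]
    refine pow_le_pow_left₀ (Real.exp_pos _).le ?_ _
    rw [Real.exp_neg, one_div]
    exact inv_anti₀ (by norm_num) (by linarith [Real.add_one_le_exp 1])
  have h2 : ∑ k ∈ Finset.range K, (1 / 2 : ℝ) ^ (k + 1) = 1 - (1 / 2 : ℝ) ^ K := by
    induction K with
    | zero => simp
    | succ K ih => rw [Finset.sum_range_succ, ih]; ring
  refine (Finset.sum_le_sum fun k _ => h1 k).trans ?_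
  rw [h2]
  linarith [pow_nonneg (by norm_num : (0 : ℝ) ≤ 1 / 2) K]

/-- Deterministic part of the chaining argument. -/
theorem exp_sum_le_of_level_bounds {K : ℕ} {x l : ℕ → ℝ} {b Q : ℝ} (hQ : 0 ≤ Q) (hb : 0 ≤ b)
    (hl : ∀ k, (4 / 9 : ℝ) ^ k * l k ≤ b)
    (hz : ∀ k ∈ Finset.range K,
      Real.exp (x k / ((3 / 4) ^ k / 4 * (4 / 9) ^ k) - l k) ≤ Q) :
    Real.exp (∑ k ∈ Finset.range K, x k) ≤ Real.exp b * (1 + Q) := by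
  have hq0 : 0 ≤ Real.log (1 + Q) := Real.log_nonneg (by linarith)
  -- Write x_k = p_k τ_k z_k, where z_k ≤ l_k + log(1+Q). Since τ_k l_k ≤ b and τ_k ≤ 1, each level
  -- costs at most its share p_k of one total b + log(1+Q). Hence Q enters the final bound only to
  -- the first power, and its expectation suffices.
  have hlevel : ∀ k ∈ Finset.range K, x k ≤ (3 / 4) ^ k / 4 * (b + Real.log (1 + Q)) := by
    intro k hk
    have hp : (0 : ℝ) < (3 / 4) ^ k / 4 := by positivity
    have hτ : (0 : ℝ) < (4 / 9) ^ k := by positivity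
    have hτ1 : (4 / 9 : ℝ) ^ k ≤ 1 := pow_le_one₀ (by norm_num) (by norm_num)
    set z := x k / ((3 / 4) ^ k / 4 * (4 / 9) ^ k) with hzdef
    have h1 : z - l k ≤ Real.log (1 + Q) := by
      rw [Real.le_log_iff_exp_le (by linarith)]
      linarith [hz k hk]
    have h2 : x k = (3 / 4) ^ k / 4 * ((4 / 9) ^ k * z) := by
      rw [hzdef]; field_simp
    rw [h2]
    refine mul_le_mul_of_nonneg_left ?_ hp.le
    nlinarith [hl k, mul_le_mul_of_nonneg_left h1 hτ.le, mul_le_mul_of_nonneg_right hτ1 hq0]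
  have hsum : ∑ k ∈ Finset.range K, x k ≤ b + Real.log (1 + Q) := by
    refine (Finset.sum_le_sum hlevel).trans ?_
    rw [← Finset.sum_mul]
    exact mul_le_of_le_one_left (by positivity) (sum_chainWeight_le K)
  calc Real.exp (∑ k ∈ Finset.range K, x k) ≤ Real.exp (b + Real.log (1 + Q)) :=
        Real.exp_le_exp.2 hsum
    _ = Real.exp b * (1 + Q) := by rw [Real.exp_add, Real.exp_log (by linarith)]

variable {X Θ T : Type*} [MeasurableSpace X] [MeasurableSpace Θ]

open scoped ENNReal in
/-- Chaining: for a class of functions with small nets at all dyadic scales, the exponential moments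
of the largest empirical deviation are controlled without a logarithmic loss. -/
theorem exists_chaining_bound (P : Kernel Θ X) [IsMarkovKernel P] (f : T → X → ℝ)
    (hf : ∀ t, Measurable (f t)) {R d : ℝ} (hR : 0 < R) (hd : 1 ≤ d)
    (hbdd : ∀ t x, |f t x| ≤ R) (π : ℕ → T → T) (S : ℕ → Finset T) (hπ : ∀ k t, π k t ∈ S k)
    (hS : ∀ k, ((S k).card : ℝ) ≤ Real.exp (d * (k + 1)))
    (happrox : ∀ k t x, |f t x - f (π k t) x| ≤ R / 2 ^ k) (h0 : ∀ t x, f (π 0 t) x = 0)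
    {m : ℕ} (hm : 0 < m) {lam : ℝ} (hlam : 0 ≤ lam) :
    ∃ W : Θ → (Fin m → X) → ℝ≥0∞, Measurable (Function.uncurry W) ∧
      (∀ θ x t, ENNReal.ofReal (Real.exp (lam * |empDev (P θ) (f t) x|)) ≤ W θ x) ∧
      ∀ θ, ∫⁻ x, W θ x ∂(Measure.pi fun _ => P θ)
        ≤ ENNReal.ofReal (Real.exp (7 * d + 32 * lam ^ 2 * R ^ 2 / m)) := by
  classical
  have hm' : (0 : ℝ) < m := by exact_mod_cast hm
  have hint : ∀ θ t, Integrable (f t) (P θ) := fun θ t =>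
    Integrable.of_mem_Icc (-R) R (hf t).aemeasurable (.of_forall fun x => abs_le.1 (hbdd t x))
  -- The chain stops where the remaining deviation contributes at most 1 to the exponent, that is, a
  -- factor e.
  obtain ⟨K, hK⟩ : ∃ K : ℕ, lam * (2 * (R / 2 ^ K)) ≤ 1 := by
    obtain ⟨K, hK⟩ := pow_unbounded_of_one_lt (lam * (2 * R)) (by norm_num : (1 : ℝ) < 2)
    refine ⟨K, ?_⟩
    rw [← mul_div_assoc, ← mul_div_assoc, div_le_one (by positivity)]
    exact hK.le
  let links : ℕ → Finset (T × T) := fun k =>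
    (S k ×ˢ S (k + 1)).filter fun q => ∀ x, |f q.2 x - f q.1 x| ≤ 2 * R / 2 ^ k
  let c : ℕ → ℝ := fun k => lam / ((3 / 4) ^ k / 4 * (4 / 9) ^ k)
  let v : ℕ → ℝ := fun k => c k ^ 2 * (2 * R / 2 ^ k) ^ 2 / (2 * m)
  -- The three summands pay for the logarithm of the number of links, for summability over k, and
  -- for the Hoeffding exponent of a link.
  let l : ℕ → ℝ := fun k => d * (2 * k + 3) + (k + 1) + v k
  let b : ℝ := 4 * d + 32 * lam ^ 2 * R ^ 2 / m
  let dev : Θ → (Fin m → X) → T × T → ℝ := fun θ x q =>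
    empDev (P θ) (fun y => f q.2 y - f q.1 y) x
  let Q : Θ → (Fin m → X) → ℝ := fun θ x => ∑ k ∈ Finset.range K, ∑ q ∈ links k,
    (Real.exp (c k * dev θ x q) + Real.exp (-c k * dev θ x q)) * Real.exp (-l k)
  have hQ0 : ∀ θ x, 0 ≤ Q θ x := fun θ x =>
    Finset.sum_nonneg fun k _ => Finset.sum_nonneg fun q _ => by positivity
  have hb0 : 0 ≤ b := by positivity
  have hc0 : ∀ k, 0 ≤ c k := fun k => by positivity
  have hl : ∀ k, (4 / 9 : ℝ) ^ k * l k ≤ b := by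
    intro k
    -- The ratios are matched: (4/9)(3/4)²2² = 1, so the variance term is the same at every level.
    have hv : (4 / 9 : ℝ) ^ k * v k = 32 * lam ^ 2 * R ^ 2 / m := by
      have h4 : (4 / 9 : ℝ) ^ k * ((3 / 4) ^ k) ^ 2 * (2 ^ k) ^ 2 = 1 := by
        rw [← pow_mul, ← pow_mul, mul_comm k 2, pow_mul, pow_mul, ← mul_pow, ← mul_pow]
        norm_num
      have hp : ((3 / 4 : ℝ) ^ k) ≠ 0 := by positivity
      have hτ : ((4 / 9 : ℝ) ^ k) ≠ 0 := by positivity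
      have h2 : ((2 : ℝ) ^ k) ≠ 0 := by positivity
      simp only [v, c]
      generalize (3 / 4 : ℝ) ^ k = p at *
      generalize (4 / 9 : ℝ) ^ k = τ at *
      generalize (2 : ℝ) ^ k = u at *
      have : τ * ((lam / (p / 4 * τ)) ^ 2 * (2 * R / u) ^ 2 / (2 * m))
          = 32 * lam ^ 2 * R ^ 2 / m / (τ * p ^ 2 * u ^ 2) := by
        field_simp
        ring
      rw [this, h4, div_one]
    have hτ : (0 : ℝ) ≤ (4 / 9) ^ k := by positivity
    have hlin := linear_mul_chainExponent_le k
    have hk : (0 : ℝ) ≤ k := k.cast_nonneg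
    have h1 : d * (2 * k + 3) + (k + 1 : ℝ) ≤ d * (3 * k + 4) := by nlinarith
    calc (4 / 9 : ℝ) ^ k * l k
        = (4 / 9 : ℝ) ^ k * (d * (2 * k + 3) + (k + 1 : ℝ)) + (4 / 9 : ℝ) ^ k * v k := by
          simp only [l]; ring
      _ ≤ (4 / 9 : ℝ) ^ k * (d * (3 * k + 4)) + 32 * lam ^ 2 * R ^ 2 / m := by
          rw [hv]
          exact add_le_add (mul_le_mul_of_nonneg_left h1 hτ) le_rfl
      _ = d * ((3 * k + 4) * (4 / 9 : ℝ) ^ k) + 32 * lam ^ 2 * R ^ 2 / m := by ring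
      _ ≤ b := by
          have := mul_le_mul_of_nonneg_left hlin (by linarith : (0 : ℝ) ≤ d)
          simp only [b]
          linarith
  have hdevmeas : ∀ q : T × T, Measurable fun p : Θ × (Fin m → X) => dev p.1 p.2 q := fun q =>
    measurable_empDev P ((hf q.2).sub (hf q.1))
  have hlinkmem : ∀ k t, (π k t, π (k + 1) t) ∈ links k := by
    intro k t
    refine Finset.mem_filter.2 ⟨Finset.mem_product.2 ⟨hπ k t, hπ (k + 1) t⟩, fun x => ?_⟩
    have h1 := happrox k t x
    have h2 := happrox (k + 1) t x
    have h3 : R / 2 ^ (k + 1) ≤ R / 2 ^ k :=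
      div_le_div_of_nonneg_left hR.le (by positivity)
        (pow_le_pow_right₀ (by norm_num) (Nat.le_succ k))
    have h4 : 2 * R / 2 ^ k = R / 2 ^ k + R / 2 ^ k := by ring
    rw [abs_le] at *
    constructor <;> linarith [h1.1, h1.2, h2.1, h2.2]
  have hpoint : ∀ θ x t, Real.exp (lam * |empDev (P θ) (f t) x|)
      ≤ Real.exp 1 * (Real.exp b * (1 + Q θ x)) := by
    intro θ x t
    have htel : empDev (P θ) (f t) x = (∑ k ∈ Finset.range K, dev θ x (π k t, π (k + 1) t))
        + empDev (P θ) (fun y => f t y - f (π K t) y) x := by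
      have hz : empDev (P θ) (f (π 0 t)) x = 0 := by simp [empDev, h0]
      have hsum : ∑ k ∈ Finset.range K, dev θ x (π k t, π (k + 1) t)
          = ∑ k ∈ Finset.range K,
            (empDev (P θ) (f (π (k + 1) t)) x - empDev (P θ) (f (π k t)) x) :=
        Finset.sum_congr rfl fun k _ => empDev_sub (hint θ _) (hint θ _) x
      rw [hsum, Finset.sum_range_sub (fun k => empDev (P θ) (f (π k t)) x),
        empDev_sub (hint θ _) (hint θ _), hz]
      ring
    have habs : lam * |empDev (P θ) (f t) x| ≤
        1 + ∑ k ∈ Finset.range K, lam * |dev θ x (π k t, π (k + 1) t)| := by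
      have h1 : |empDev (P θ) (f t) x| ≤
          (∑ k ∈ Finset.range K, |dev θ x (π k t, π (k + 1) t)|) + 2 * (R / 2 ^ K) := by
        rw [htel]
        exact (abs_add_le _ _).trans (add_le_add (Finset.abs_sum_le_sum_abs _ _)
          (abs_empDev_le (happrox K t) x))
      have h2 := mul_le_mul_of_nonneg_left h1 hlam
      rw [mul_add, Finset.mul_sum] at h2
      linarith
    refine (Real.exp_le_exp.2 habs).trans ?_
    rw [Real.exp_add]
    refine mul_le_mul_of_nonneg_left ?_ (Real.exp_pos _).le
    refine exp_sum_le_of_level_bounds (hQ0 θ x) hb0 hl fun k hk => ?_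
    set q := (π k t, π (k + 1) t) with hq
    have h1 : lam * |dev θ x q| / ((3 / 4) ^ k / 4 * (4 / 9) ^ k) = |c k * dev θ x q| := by
      rw [abs_mul, abs_of_nonneg (hc0 k)]
      simp only [c]
      ring
    rw [h1, sub_eq_add_neg, Real.exp_add]
    have h2 : Real.exp |c k * dev θ x q| ≤
        Real.exp (c k * dev θ x q) + Real.exp (-c k * dev θ x q) := by
      rw [neg_mul]
      exact Real.exp_abs_le _
    calc _ ≤ (Real.exp (c k * dev θ x q) + Real.exp (-c k * dev θ x q)) * Real.exp (-l k) :=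
          mul_le_mul_of_nonneg_right h2 (Real.exp_pos _).le
      _ ≤ ∑ q ∈ links k,
            (Real.exp (c k * dev θ x q) + Real.exp (-c k * dev θ x q)) * Real.exp (-l k) :=
          Finset.single_le_sum (f := fun q => (Real.exp (c k * dev θ x q)
            + Real.exp (-c k * dev θ x q)) * Real.exp (-l k))
            (fun q _ => by positivity) (hlinkmem k t)
      _ ≤ Q θ x :=
          Finset.single_le_sum (f := fun k => ∑ q ∈ links k, (Real.exp (c k * dev θ x q)
            + Real.exp (-c k * dev θ x q)) * Real.exp (-l k))
            (fun k _ => Finset.sum_nonneg fun q _ => by positivity) hk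
  refine ⟨fun θ x => ENNReal.ofReal (Real.exp 1 * (Real.exp b * (1 + Q θ x))), ?_,
    fun θ x t => ENNReal.ofReal_le_ofReal (hpoint θ x t), fun θ => ?_⟩
  · refine ENNReal.measurable_ofReal.comp ?_
    refine measurable_const.mul (measurable_const.mul (measurable_const.add ?_))
    refine Finset.measurable_sum _ fun k _ => Finset.measurable_sum _ fun q _ => ?_
    have := hdevmeas q
    fun_prop
  · have hdx : ∀ q, Measurable fun x => dev θ x q := fun q =>
      (hdevmeas q).comp measurable_prodMk_left
    have hform : ∀ x, ENNReal.ofReal (Real.exp 1 * (Real.exp b * (1 + Q θ x))) =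
        ENNReal.ofReal (Real.exp 1 * Real.exp b) * (1 + ∑ k ∈ Finset.range K, ∑ q ∈ links k,
          (ENNReal.ofReal (Real.exp (c k * dev θ x q)) +
            ENNReal.ofReal (Real.exp (-c k * dev θ x q))) * ENNReal.ofReal (Real.exp (-l k))) := by
      intro x
      rw [← mul_assoc, ENNReal.ofReal_mul (by positivity),
        ENNReal.ofReal_add zero_le_one (hQ0 θ x), ENNReal.ofReal_one]
      congr 2
      rw [ENNReal.ofReal_sum_of_nonneg
        fun k _ => Finset.sum_nonneg fun q _ => by positivity]
      refine Finset.sum_congr rfl fun k _ => ?_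
      rw [ENNReal.ofReal_sum_of_nonneg fun q _ => by positivity]
      refine Finset.sum_congr rfl fun q _ => ?_
      rw [ENNReal.ofReal_mul (by positivity), ENNReal.ofReal_add (by positivity) (by positivity)]
    have hterm : ∀ k, ∀ q ∈ links k,
        ∫⁻ x, (ENNReal.ofReal (Real.exp (c k * dev θ x q)) +
            ENNReal.ofReal (Real.exp (-c k * dev θ x q))) * ENNReal.ofReal (Real.exp (-l k))
          ∂(Measure.pi fun _ => P θ)
          ≤ ENNReal.ofReal (2 * Real.exp (v k) * Real.exp (-l k)) := by
      intro k q hq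
      have hg := (Finset.mem_filter.1 hq).2
      have hgm : Measurable fun y => f q.2 y - f q.1 y := (hf q.2).sub (hf q.1)
      have hd' := hdx q
      rw [lintegral_mul_const _ (by fun_prop), lintegral_add_left (by fun_prop),
        ENNReal.ofReal_mul (by positivity)]
      gcongr
      rw [two_mul, ENNReal.ofReal_add (by positivity) (by positivity)]
      refine add_le_add (lintegral_exp_mul_empDev_le hgm hg hm (c k)) ?_
      refine (lintegral_exp_mul_empDev_le hgm hg hm (-c k)).trans_eq ?_
      rw [neg_sq]
    have hlevel : ∀ k, ∑ q ∈ links k, ENNReal.ofReal (2 * Real.exp (v k) * Real.exp (-l k))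
        ≤ ENNReal.ofReal (2 * Real.exp (-(k + 1 : ℝ))) := by
      intro k
      have hcard : ((links k).card : ℝ) ≤ Real.exp (d * (2 * k + 3)) := by
        have h1 : (links k).card ≤ (S k).card * (S (k + 1)).card :=
          (Finset.card_filter_le _ _).trans_eq (Finset.card_product _ _)
        calc ((links k).card : ℝ) ≤ (S k).card * (S (k + 1)).card := by exact_mod_cast h1
          _ ≤ Real.exp (d * (k + 1)) * Real.exp (d * ((k + 1 : ℕ) + 1)) :=
              mul_le_mul (hS k) (hS (k + 1)) (Nat.cast_nonneg _) (Real.exp_pos _).le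
          _ = Real.exp (d * (2 * k + 3)) := by
              rw [← Real.exp_add]; push_cast; ring_nf
      rw [Finset.sum_const, nsmul_eq_mul, ← ENNReal.ofReal_natCast,
        ← ENNReal.ofReal_mul (Nat.cast_nonneg _)]
      refine ENNReal.ofReal_le_ofReal ?_
      have hsplit : Real.exp (-(k + 1 : ℝ)) =
          Real.exp (d * (2 * k + 3)) * (Real.exp (v k) * Real.exp (-l k)) := by
        rw [← Real.exp_add, ← Real.exp_add]
        congr 1
        simp only [l]
        ring
      rw [hsplit]
      have := mul_le_mul_of_nonneg_right hcard
        (by positivity : 0 ≤ 2 * (Real.exp (v k) * Real.exp (-l k)))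
      linarith
    simp_rw [hform]
    have hQm : Measurable fun x => ∑ k ∈ Finset.range K, ∑ q ∈ links k,
          (ENNReal.ofReal (Real.exp (c k * dev θ x q)) +
            ENNReal.ofReal (Real.exp (-c k * dev θ x q))) * ENNReal.ofReal (Real.exp (-l k)) := by
      refine Finset.measurable_sum _ fun k _ => Finset.measurable_sum _ fun q _ => ?_
      have := hdx q
      fun_prop
    rw [lintegral_const_mul _ (hQm.const_add 1), lintegral_add_left measurable_const, lintegral_const, measure_univ, mul_one]
    have hsumQ : ∫⁻ x, ∑ k ∈ Finset.range K, ∑ q ∈ links k,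
          (ENNReal.ofReal (Real.exp (c k * dev θ x q)) +
            ENNReal.ofReal (Real.exp (-c k * dev θ x q))) * ENNReal.ofReal (Real.exp (-l k))
          ∂(Measure.pi fun _ => P θ) ≤ ENNReal.ofReal 2 := by
      rw [lintegral_finsetSum _ fun k _ => by
        refine Finset.measurable_sum _ fun q _ => ?_
        have := hdx q
        fun_prop]
      calc _ ≤ ∑ k ∈ Finset.range K, ENNReal.ofReal (2 * Real.exp (-(k + 1 : ℝ))) := by
            refine Finset.sum_le_sum fun k _ => ?_
            rw [lintegral_finsetSum _ fun q _ => by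
              have := hdx q
              fun_prop]
            exact (Finset.sum_le_sum (hterm k)).trans (hlevel k)
        _ ≤ ENNReal.ofReal 2 := by
            rw [← ENNReal.ofReal_sum_of_nonneg fun k _ => by positivity]
            refine ENNReal.ofReal_le_ofReal ?_
            rw [← Finset.mul_sum]
            linarith [sum_exp_neg_succ_le K]
    calc _ ≤ ENNReal.ofReal (Real.exp 1 * Real.exp b) * (1 + ENNReal.ofReal 2) := by gcongr
      _ = ENNReal.ofReal (Real.exp 1 * Real.exp b * 3) := by
          rw [ENNReal.ofReal_mul (by positivity) (q := 3), ← ENNReal.ofReal_one,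
            ← ENNReal.ofReal_add zero_le_one zero_le_two]
          norm_num
      _ ≤ _ := by
          refine ENNReal.ofReal_le_ofReal ?_
          -- The factor 3 is 1 plus the bound 2 on the expectation of Q. The total exponent 1 + b +
          -- 2 fits because b contains 4d and d ≥ 1.
          have h3 : (3 : ℝ) ≤ Real.exp 2 := by linarith [Real.add_one_le_exp (2 : ℝ)]
          calc Real.exp 1 * Real.exp b * 3 ≤ Real.exp 1 * Real.exp b * Real.exp 2 := by gcongr
            _ = Real.exp (1 + b + 2) := by rw [Real.exp_add (1 + b), Real.exp_add 1 b]
            _ ≤ _ := Real.exp_le_exp.2 (by simp only [b]; linarith)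

end Chaining

/-! ### Laws of the outer sample and of a single row. -/

section NestedSample

open Set

variable {Ω X Θ : Type*} [MeasurableSpace Ω] [MeasurableSpace X] [MeasurableSpace Θ]

/-- The kernel of `m` independent draws from `P θ`. -/
noncomputable def iidKernel (P : Kernel Θ X) [IsMarkovKernel P] (m : ℕ) :
    Kernel Θ (Fin m → X) where
  toFun θ := Measure.pi fun _ => P θ
  measurable' := by
    refine Measurable.measure_of_isPiSystem_of_isProbabilityMeasure generateFrom_pi.symm
      isPiSystem_pi ?_
    rintro _ ⟨b, hb, rfl⟩
    simp only [Measure.pi_pi]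
    exact Finset.measurable_prod _ fun j _ => P.measurable_coe (hb j (mem_univ j))

theorem iidKernel_apply (P : Kernel Θ X) [IsMarkovKernel P] (m : ℕ) (θ : Θ) :
    iidKernel P m θ = Measure.pi fun _ => P θ := rfl

instance (P : Kernel Θ X) [IsMarkovKernel P] (m : ℕ) : IsMarkovKernel (iidKernel P m) :=
  ⟨fun θ => by rw [iidKernel_apply]; infer_instance⟩

variable {Pr : Measure Ω} {μ : Measure Θ} [IsProbabilityMeasure μ]
  {P : Kernel Θ X} [IsMarkovKernel P] {N M : ℕ} {θ : Fin N → Ω → Θ} {ξ : Fin N → Fin M → Ω → X}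

theorem IsNestedSample.map_outer (h : IsNestedSample Pr μ P θ ξ) :
    Pr.map (fun ω i => θ i ω) = Measure.pi fun _ : Fin N => μ := by
  refine (Measure.pi_eq fun s hs => ?_).symm
  have hθ : Measurable fun ω i => θ i ω := measurable_pi_lambda _ h.1
  rw [Measure.map_apply hθ (MeasurableSet.univ_pi hs)]
  have := h.2.2 s (fun _ _ => univ) hs fun _ _ => MeasurableSet.univ
  simp only [mem_univ, implies_true, and_true, measure_univ, Finset.prod_const_one,
    lintegral_one, Measure.restrict_apply_univ] at this
  rw [← this]
  congr 1
  ext ω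
  simp

variable [IsProbabilityMeasure Pr]

theorem IsNestedSample.map_row (h : IsNestedSample Pr μ P θ ξ) (i : Fin N) :
    Pr.map (fun ω => (θ i ω, fun j => ξ i j ω)) = μ ⊗ₘ iidKernel P M := by
  classical
  have hξ : Measurable fun ω j => ξ i j ω := measurable_pi_lambda _ (h.2.1 i)
  have hpair : Measurable fun ω => (θ i ω, fun j => ξ i j ω) := (h.1 i).prodMk hξ
  refine Measure.ext_prod fun {s t} hs ht => ?_
  have hrect : ∀ b : Fin M → Set X, (∀ j, MeasurableSet (b j)) →
      Pr {ω | θ i ω ∈ s ∧ ∀ j, ξ i j ω ∈ b j} = ∫⁻ u in s, ∏ j, P u (b j) ∂μ := by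
    intro b hb
    -- Full spaces in all other rows make their factors equal to 1.
    have := h.2.2 (fun i' => if i' = i then s else univ)
      (fun i' j => if i' = i then b j else univ)
      (fun i' => by split_ifs; exacts [hs, MeasurableSet.univ])
      (fun i' j => by split_ifs; exacts [hb j, MeasurableSet.univ])
    rw [Fintype.prod_eq_single i] at this
    · simp only [if_true] at this
      rw [← this]
      congr 1
      ext ω
      simp only [mem_ofPred_eq]
      constructor
      · intro hω i'
        by_cases hi : i' = i
        · subst hi
          simpa using hω
        · simp [hi]
      · intro hω
        simpa using hω i
    · intro i' hi
      simp [hi]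
  -- With the parameter set s fixed, two finite measures on the row space agree on boxes and in
  -- total mass.
  have hmeas : (Pr.restrict (θ i ⁻¹' s)).map (fun ω j => ξ i j ω)
      = (μ.restrict s).bind (iidKernel P M) := by
    refine ext_of_generate_finite _ generateFrom_pi.symm isPiSystem_pi ?_ ?_
    · rintro _ ⟨b, hb, rfl⟩
      have hb' : ∀ j, MeasurableSet (b j) := fun j => hb j (mem_univ j)
      have hbox := MeasurableSet.univ_pi hb'
      rw [Measure.map_apply hξ hbox, Measure.restrict_apply (hξ hbox),
        Measure.bind_apply hbox (iidKernel P M).aemeasurable]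
      simp only [iidKernel_apply, Measure.pi_pi]
      rw [← hrect b hb']
      congr 1
      ext ω
      simp [and_comm]
    · rw [Measure.map_apply hξ .univ, Measure.bind_apply .univ (iidKernel P M).aemeasurable]
      have := hrect (fun _ => univ) fun _ => MeasurableSet.univ
      simp only [mem_univ, implies_true, and_true, measure_univ, Finset.prod_const_one,
        lintegral_one, Measure.restrict_apply_univ] at this
      simp only [preimage_univ, Measure.restrict_apply_univ, measure_univ, lintegral_one]
      exact this
  rw [Measure.map_apply hpair (hs.prod ht), Measure.compProd_apply_prod hs ht,
    ← Measure.bind_apply ht (iidKernel P M).aemeasurable, ← hmeas, Measure.map_apply hξ ht,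
    Measure.restrict_apply (hξ ht)]
  congr 1
  ext ω
  simp [and_comm]

theorem IsNestedSample.lintegral_row (h : IsNestedSample Pr μ P θ ξ) (i : Fin N)
    {W : Θ → (Fin M → X) → ENNReal} (hW : Measurable (Function.uncurry W)) :
    ∫⁻ ω, W (θ i ω) (fun j => ξ i j ω) ∂Pr
      = ∫⁻ t, ∫⁻ x, W t x ∂(Measure.pi fun _ => P t) ∂μ := by
  have hpair : Measurable fun ω => (θ i ω, fun j => ξ i j ω) :=
    (h.1 i).prodMk (measurable_pi_lambda _ (h.2.1 i))
  have h1 := lintegral_map (μ := Pr) hW hpair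
  rw [h.map_row i, Measure.lintegral_compProd hW] at h1
  exact h1.symm

end NestedSample

/-! ### The class of shifted positive parts. -/

section PosPartClass

open Set Module

variable {E : Type*} [NormedAddCommGroup E] {X Θ : Type*}

/-- The shifted positive parts `max (F a · - u) 0` with `a ∈ A` and `|u| ≤ B` have small nets at
every dyadic scale. -/
theorem exists_posPart_net [NormedSpace ℝ E] [FiniteDimensional ℝ E] {A : Set E}
    {F : E → X → ℝ} {B L D : ℝ} (hB : 0 < B) (hL : 0 < L) (hD : 0 < D)
    (hAD : ∀ a ∈ A, ‖a‖ ≤ D)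
    (hLip : ∀ a₁ ∈ A, ∀ a₂ ∈ A, ∀ x, |F a₁ x - F a₂ x| ≤ L * ‖a₁ - a₂‖) (k : ℕ) :
    ∃ (S : Finset (A × Icc (-B) B)) (π : A × Icc (-B) B → A × Icc (-B) B),
      (∀ t, π t ∈ S) ∧ (S.card : ℝ) ≤ Real.exp ((finrank ℝ E + 1 : ℝ) * (k + 1)) ∧
      ∀ t x, |max (F t.1 x - t.2) 0 - max (F (π t).1 x - (π t).2) 0|
        ≤ 4 * (B + L * D) / 2 ^ k := by
  classical
  have hLD : 0 < L * D := mul_pos hL hD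
  -- This R makes both ratios 2D/r and 2B/r at most 2^k, with half of the tolerance R/2^k spent on
  -- the action and half on the threshold.
  set R := 4 * (B + L * D) with hR
  have hR0 : 0 < R := by positivity
  have h2k : (0 : ℝ) < 2 ^ k := by positivity
  obtain ⟨SA, hSA, hcA, hnA⟩ := exists_finset_net A (r := R / 2 ^ k / (2 * L)) (by positivity)
    hD.le hAD
  obtain ⟨SU, hSU, hcU, hnU⟩ := exists_finset_net (Icc (-B) B) (r := R / 2 ^ k / 2) (by positivity)
    hB.le fun c hc => abs_le.2 hc
  have hbase : (1 + 2 ^ k : ℝ) ≤ Real.exp (k + 1) := by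
    have h2 : (2 : ℝ) ≤ Real.exp 1 := by linarith [Real.add_one_le_exp (1 : ℝ)]
    calc (1 + 2 ^ k : ℝ) ≤ 2 ^ (k + 1) := by
          rw [pow_succ]; linarith [one_le_pow₀ (n := k) (by norm_num : (1 : ℝ) ≤ 2)]
      _ ≤ Real.exp 1 ^ (k + 1) := pow_le_pow_left₀ (by norm_num) h2 _
      _ = Real.exp (k + 1) := by rw [← Real.exp_nat_mul]; push_cast; ring_nf
  have hA' : (1 + 2 * D / (R / 2 ^ k / (2 * L))) ≤ Real.exp (k + 1) := by
    refine le_trans (add_le_add le_rfl ?_) hbase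
    rw [div_div, div_div_eq_mul_div, div_le_iff₀ hR0]
    have : 0 ≤ 2 ^ k * B := by positivity
    rw [hR]
    nlinarith
  have hU' : (1 + 2 * B / (R / 2 ^ k / 2)) ≤ Real.exp (k + 1) := by
    refine le_trans (add_le_add le_rfl ?_) hbase
    rw [div_div, div_div_eq_mul_div, div_le_iff₀ hR0]
    have : 0 ≤ 2 ^ k * (L * D) := by positivity
    rw [hR]
    nlinarith
  have hproj : ∀ t : A × Icc (-B) B, ∃ t' : A × Icc (-B) B,
      t' ∈ SA.subtype (· ∈ A) ×ˢ SU.subtype (· ∈ Icc (-B) B) ∧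
      ‖(t.1 : E) - t'.1‖ ≤ R / 2 ^ k / (2 * L) ∧ |(t.2 : ℝ) - t'.2| ≤ R / 2 ^ k / 2 := by
    rintro ⟨⟨a, ha⟩, ⟨u, hu⟩⟩
    obtain ⟨a', ha', haa⟩ := hnA a ha
    obtain ⟨u', hu', huu⟩ := hnU u hu
    exact ⟨(⟨a', hSA a' ha'⟩, ⟨u', hSU u' hu'⟩),
      Finset.mem_product.2 ⟨Finset.mem_subtype.2 ha', Finset.mem_subtype.2 hu'⟩, haa, huu⟩
  choose π hπS hπA hπU using hproj
  refine ⟨_, π, hπS, ?_, fun t x => ?_⟩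
  · rw [Finset.card_product, Nat.cast_mul]
    have h1 : ((SA.subtype (· ∈ A)).card : ℝ) ≤ Real.exp (k + 1) ^ finrank ℝ E := by
      rw [Finset.card_subtype]
      exact (Nat.cast_le.2 (Finset.card_filter_le _ _)).trans
        (hcA.trans (pow_le_pow_left₀ (by positivity) hA' _))
    have h2 : ((SU.subtype (· ∈ Icc (-B) B)).card : ℝ) ≤ Real.exp (k + 1) := by
      rw [Finset.card_subtype]
      refine (Nat.cast_le.2 (Finset.card_filter_le _ _)).trans (hcU.trans ?_)
      rw [finrank_self, pow_one]
      exact hU'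
    refine (mul_le_mul h1 h2 (Nat.cast_nonneg _) (by positivity)).trans_eq ?_
    rw [← Real.exp_nat_mul, ← Real.exp_add]
    ring_nf
  · refine (abs_max_sub_max_le_abs _ _ _).trans ?_
    have h1 := hLip t.1 t.1.2 (π t).1 (π t).1.2 x
    have h2 := hπU t
    have h3 : L * ‖(t.1 : E) - (π t).1‖ ≤ R / 2 ^ k / 2 := by
      refine (mul_le_mul_of_nonneg_left (hπA t) hL.le).trans_eq ?_
      field_simp
    rw [abs_le] at *
    constructor <;> linarith [h1.1, h1.2, h2.1, h2.2]

variable [MeasurableSpace X] [MeasurableSpace Θ]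

/-- Above B the positive part vanishes, and below -B moving the threshold only adds a constant.
Empirical deviations ignore constants, so u in [-B, B] suffices. -/
theorem posPart_sub_eq_clamp {B y : ℝ} (hy : |y| ≤ B) (u : ℝ) :
    max (y - u) 0 = max (y - max (-B) (min B u)) 0 + max (-B - u) 0 := by
  have h := abs_le.1 hy
  rcases le_total B u with hBu | hBu
  · rw [min_eq_left hBu, max_eq_right (a := -B) (by linarith), max_eq_right (by linarith),
      max_eq_right (by linarith), max_eq_right (by linarith), add_zero]
  · rw [min_eq_right hBu]
    rcases le_total (-B) u with hu | hu
    · rw [max_eq_right hu, max_eq_right (a := -B - u) (by linarith), add_zero]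
    · rw [max_eq_left hu, max_eq_left (by linarith), max_eq_left (by linarith),
        max_eq_left (by linarith)]
      ring

theorem empDev_add_const {m : ℕ} (hm : 0 < m) {ν : Measure X} [IsProbabilityMeasure ν] {f : X → ℝ}
    (hf : Integrable f ν) (c : ℝ) (x : Fin m → X) :
    empDev ν (fun y => f y + c) x = empDev ν f x := by
  have hm' : (m : ℝ) ≠ 0 := by exact_mod_cast hm.ne'
  simp only [empDev, Finset.sum_add_distrib, integral_add hf (integrable_const c), integral_const,
    probReal_univ, one_smul, Finset.sum_const, Finset.card_univ, Fintype.card_fin, nsmul_eq_mul]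
  field_simp
  ring

open scoped ENNReal in
/-- Exponential moments of the largest deviation of the class of shifted positive parts. -/
theorem exists_posPart_bound [NormedSpace ℝ E] [FiniteDimensional ℝ E] (P : Kernel Θ X)
    [IsMarkovKernel P] {A : Set E} (hAne : A.Nonempty) {F : E → X → ℝ} {B L D : ℝ} (hB : 0 < B)
    (hL : 0 < L) (hD : 0 < D) (hAD : ∀ a ∈ A, ‖a‖ ≤ D) (hF : ∀ a ∈ A, Measurable (F a))
    (hFB : ∀ a ∈ A, ∀ x, |F a x| ≤ B)
    (hLip : ∀ a₁ ∈ A, ∀ a₂ ∈ A, ∀ x, |F a₁ x - F a₂ x| ≤ L * ‖a₁ - a₂‖)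
    {m : ℕ} (hm : 0 < m) {lam : ℝ} (hlam : 0 ≤ lam) :
    ∃ W : Θ → (Fin m → X) → ℝ≥0∞, Measurable (Function.uncurry W) ∧
      (∀ θ x, ∀ a ∈ A, ∀ u : ℝ, ENNReal.ofReal (Real.exp
        (lam * |empDev (P θ) (fun y => max (F a y - u) 0) x|)) ≤ W θ x) ∧
      ∀ θ, ∫⁻ x, W θ x ∂(Measure.pi fun _ => P θ) ≤ ENNReal.ofReal
        (Real.exp (7 * (finrank ℝ E + 1) + 32 * lam ^ 2 * (4 * (B + L * D)) ^ 2 / m)) := by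
  have hLD : 0 < L * D := mul_pos hL hD
  obtain ⟨a₀, ha₀⟩ := hAne
  let f : A × Icc (-B) B → X → ℝ := fun t x => max (F t.1 x - t.2) 0
  -- At threshold B the function is zero. It replaces the net at level 0, so every chain starts from
  -- deviation zero.
  let t₀ : A × Icc (-B) B := (⟨a₀, ha₀⟩, ⟨B, by linarith, le_rfl⟩)
  have hf0 : ∀ x, f t₀ x = 0 := fun x =>
    max_eq_right (by linarith [(abs_le.1 (hFB a₀ ha₀ x)).2] : F a₀ x - B ≤ 0)
  have hfB : ∀ t x, |f t x| ≤ 4 * (B + L * D) := by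
    intro t x
    have h1 := abs_le.1 (hFB t.1 t.1.2 x)
    have h2 := t.2.2
    rw [abs_of_nonneg (le_max_right _ _)]
    exact max_le (by linarith [h2.1, h2.2]) (by positivity)
  have hfm : ∀ t, Measurable (f t) := fun t => by
    have := hF t.1 t.1.2
    fun_prop
  choose S π hπS hcard happ using
    exists_posPart_net hB hL hD hAD hLip
  obtain ⟨W, hW, hWle, hWint⟩ := exists_chaining_bound P f hfm (R := 4 * (B + L * D))
    (d := finrank ℝ E + 1) (by positivity) (by simp) hfB
    (fun k t => if k = 0 then t₀ else π k t) (fun k => if k = 0 then {t₀} else S k)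
    (fun k t => by
      by_cases hk : k = 0
      · simp [hk]
      · simpa [hk] using hπS k t)
    (fun k => by
      by_cases hk : k = 0
      · simp only [hk, if_true, Finset.card_singleton, Nat.cast_one]
        exact Real.one_le_exp (by positivity)
      · simpa only [hk, if_false] using hcard k)
    (fun k t x => by
      by_cases hk : k = 0
      · simpa [hk, hf0] using hfB t x
      · simpa only [hk, if_false] using happ k t x)
    (fun t x => by simpa using hf0 x) hm hlam
  refine ⟨W, hW, fun θ x a ha u => ?_, hWint⟩
  have hu : max (-B) (min B u) ∈ Icc (-B) B :=
    ⟨le_max_left _ _, max_le (by linarith) (min_le_left _ _)⟩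
  have hshift : (fun y => max (F a y - u) 0)
      = fun y => max (F a y - max (-B) (min B u)) 0 + max (-B - u) 0 :=
    funext fun y => posPart_sub_eq_clamp (hFB a ha y) u
  rw [hshift, empDev_add_const hm (integrable_posPart_sub (hF a ha) (hFB a ha) _)]
  exact hWle θ x (⟨a, ha⟩, ⟨_, hu⟩)

end PosPartClass

/-! ### High-probability events for both sampling levels. -/

section Tails

open Set Module

/-- Markov's inequality for W at level e^c: the good event depends only on W, so the quantities y it
controls may be uncountably many and need not be measurable. -/
theorem exists_measurableSet_of_lintegral_exp_le {Ω : Type*} [MeasurableSpace Ω] {Pr : Measure Ω}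
    {W : Ω → ENNReal} (hW : Measurable W) {a c p : ℝ}
    (hint : ∫⁻ ω, W ω ∂Pr ≤ ENNReal.ofReal (Real.exp a)) (hp : 0 < p) (hac : a - c ≤ Real.log p) :
    ∃ G : Set Ω, MeasurableSet G ∧ Pr Gᶜ ≤ ENNReal.ofReal p ∧
      ∀ ω ∈ G, ∀ y : ℝ, ENNReal.ofReal (Real.exp y) ≤ W ω → y ≤ c := by
  refine ⟨{ω | W ω < ENNReal.ofReal (Real.exp c)}, measurableSet_lt hW measurable_const, ?_, ?_⟩
  · have hc : {ω | W ω < ENNReal.ofReal (Real.exp c)}ᶜ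
        = {ω | ENNReal.ofReal (Real.exp c) ≤ W ω} := by ext ω; simp
    rw [hc]
    have hpos : ENNReal.ofReal (Real.exp c) ≠ 0 := by simp [Real.exp_pos]
    refine (meas_ge_le_lintegral_div hW.aemeasurable hpos ENNReal.ofReal_ne_top).trans ?_
    refine (ENNReal.div_le_div_right hint _).trans ?_
    rw [← ENNReal.ofReal_div_of_pos (Real.exp_pos _), ← Real.exp_sub]
    refine ENNReal.ofReal_le_ofReal ?_
    calc _ ≤ Real.exp (Real.log p) := Real.exp_le_exp.2 hac
      _ = p := Real.exp_log hp
  · intro ω hω y hy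
    have := hy.trans_lt hω
    rw [ENNReal.ofReal_lt_ofReal_iff (Real.exp_pos _), Real.exp_lt_exp] at this
    exact this.le

/-- The value λ = mτ/(64R²) minimises 32λ²R²/m - λτ, with minimum -mτ²/(128R²). -/
theorem tail_exponent_le {m R τ q p : ℝ} (hm : 0 < m) (hR : 0 < R) (hτ : 0 < τ)
    (h : 128 * R ^ 2 / τ ^ 2 * (q + Real.log (1 / p)) ≤ m) :
    q + 32 * (m * τ / (64 * R ^ 2)) ^ 2 * R ^ 2 / m - m * τ / (64 * R ^ 2) * τ ≤ Real.log p := by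
  have h1 : q + Real.log (1 / p) ≤ m * τ ^ 2 / (128 * R ^ 2) := by
    rw [le_div_iff₀ (by positivity)]
    rw [div_mul_eq_mul_div, div_le_iff₀ (by positivity)] at h
    linarith
  have h2 : 32 * (m * τ / (64 * R ^ 2)) ^ 2 * R ^ 2 / m - m * τ / (64 * R ^ 2) * τ
      = -(m * τ ^ 2 / (128 * R ^ 2)) := by
    field_simp
    norm_num
  rw [one_div, Real.log_inv] at h1
  linarith

variable {E : Type*} [NormedAddCommGroup E] [NormedSpace ℝ E] [FiniteDimensional ℝ E]
  {Ω X Θ : Type*} [MeasurableSpace Ω] [MeasurableSpace X] [MeasurableSpace Θ]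
  {Pr : Measure Ω} {μ : Measure Θ} [IsProbabilityMeasure μ]
  {P : Kernel Θ X} [IsMarkovKernel P] {N M : ℕ} {θ : Fin N → Ω → Θ} {ξ : Fin N → Fin M → Ω → X}
  {A : Set E} {F : E → X → ℝ} {B L D : ℝ}

theorem exp_average_le {N : ℕ} (hN : 0 < N) (y : Fin N → ℝ) :
    Real.exp ((1 / (N : ℝ)) * ∑ i, y i) ≤ (1 / (N : ℝ)) * ∑ i, Real.exp (y i) := by
  have hN' : (0 : ℝ) < N := by exact_mod_cast hN
  have := convexOn_exp.map_sum_le (t := Finset.univ) (w := fun _ : Fin N => 1 / (N : ℝ)) (p := y)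
    (fun _ _ => by positivity) (by simp [hN'.ne']) (fun _ _ => Set.mem_univ _)
  simpa only [smul_eq_mul, ← Finset.mul_sum] using this

/-- With high probability the outer empirical deviations are small uniformly in the action and in the
threshold. -/
theorem IsNestedSample.exists_outer_event (h : IsNestedSample Pr μ P θ ξ) (hAne : A.Nonempty)
    {Y : E → Θ → ℝ} (hB : 0 < B) (hL : 0 < L) (hD : 0 < D) (hAD : ∀ a ∈ A, ‖a‖ ≤ D)
    (hY : ∀ a ∈ A, Measurable (Y a)) (hYB : ∀ a ∈ A, ∀ x, |Y a x| ≤ B)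
    (hLip : ∀ a₁ ∈ A, ∀ a₂ ∈ A, ∀ x, |Y a₁ x - Y a₂ x| ≤ L * ‖a₁ - a₂‖)
    (hN : 0 < N) {τ p : ℝ} (hτ : 0 < τ) (hp : 0 < p)
    (hNp : 128 * (4 * (B + L * D)) ^ 2 / τ ^ 2 * (7 * (finrank ℝ E + 1) + Real.log (1 / p)) ≤ N) :
    ∃ G : Set Ω, MeasurableSet G ∧ Pr Gᶜ ≤ ENNReal.ofReal p ∧ ∀ ω ∈ G, ∀ a ∈ A, ∀ u : ℝ,
      |empDev μ (fun t => max (Y a t - u) 0) (fun i => θ i ω)| ≤ τ := by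
  have hN' : (0 : ℝ) < N := by exact_mod_cast hN
  have hLD : 0 < L * D := mul_pos hL hD
  have hR : 0 < 4 * (B + L * D) := by positivity
  set R := 4 * (B + L * D) with hRdef
  have hlam : 0 < N * τ / (64 * R ^ 2) := by positivity
  -- The outer level has a single sampling law, treated as a constant kernel over a one-point space.
  obtain ⟨W, hW, hWle, hWint⟩ := exists_posPart_bound (Kernel.const Unit μ) hAne hB hL hD hAD hY
    hYB hLip hN hlam.le
  have hθ : Measurable fun ω i => θ i ω := measurable_pi_lambda _ h.1
  have hWu : Measurable (W ()) := hW.comp measurable_prodMk_left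
  obtain ⟨G, hG, hGp, hGle⟩ := exists_measurableSet_of_lintegral_exp_le (Pr := Pr) (hWu.comp hθ)
    (a := 7 * (finrank ℝ E + 1) + 32 * (N * τ / (64 * R ^ 2)) ^ 2 * R ^ 2 / N)
    (c := N * τ / (64 * R ^ 2) * τ) (p := p) (by
      have h1 := lintegral_map (μ := Pr) hWu hθ
      rw [h.map_outer] at h1
      rw [Function.comp_def, ← h1]
      exact hWint ()) hp (tail_exponent_le hN' hR hτ hNp)
  refine ⟨G, hG, hGp, fun ω hω a ha u => ?_⟩
  exact le_of_mul_le_mul_left (hGle ω hω _ (hWle () (fun i => θ i ω) a ha u)) hlam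

variable [IsProbabilityMeasure Pr]

/-- With high probability the inner empirical deviations are small on average over the rows, for
every action and every choice of thresholds. -/
theorem IsNestedSample.exists_inner_event (h : IsNestedSample Pr μ P θ ξ) (hAne : A.Nonempty)
    (hB : 0 < B) (hL : 0 < L) (hD : 0 < D) (hAD : ∀ a ∈ A, ‖a‖ ≤ D)
    (hF : ∀ a ∈ A, Measurable (F a)) (hFB : ∀ a ∈ A, ∀ x, |F a x| ≤ B)
    (hLip : ∀ a₁ ∈ A, ∀ a₂ ∈ A, ∀ x, |F a₁ x - F a₂ x| ≤ L * ‖a₁ - a₂‖)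
    (hN : 0 < N) (hM : 0 < M) {τ p : ℝ} (hτ : 0 < τ) (hp : 0 < p)
    (hMp : 128 * (4 * (B + L * D)) ^ 2 / τ ^ 2 * (7 * (finrank ℝ E + 1) + Real.log (1 / p)) ≤ M) :
    ∃ G : Set Ω, MeasurableSet G ∧ Pr Gᶜ ≤ ENNReal.ofReal p ∧ ∀ ω ∈ G, ∀ a ∈ A, ∀ w : Fin N → ℝ,
      (1 / (N : ℝ)) * ∑ i, |empDev (P (θ i ω)) (fun y => max (F a y - w i) 0)
        (fun j => ξ i j ω)| ≤ τ := by
  have hM' : (0 : ℝ) < M := by exact_mod_cast hM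
  have hN' : (0 : ℝ) < N := by exact_mod_cast hN
  have hLD : 0 < L * D := mul_pos hL hD
  have hR : 0 < 4 * (B + L * D) := by positivity
  set R := 4 * (B + L * D) with hRdef
  have hlam : 0 < M * τ / (64 * R ^ 2) := by positivity
  obtain ⟨W, hW, hWle, hWint⟩ := exists_posPart_bound P hAne hB hL hD hAD hF hFB hLip hM hlam.le
  have hrow : ∀ i, Measurable fun ω => W (θ i ω) fun j => ξ i j ω := fun i =>
    hW.comp ((h.1 i).prodMk (measurable_pi_lambda _ (h.2.1 i)))
  have hone : ENNReal.ofReal (1 / (N : ℝ)) * N = 1 := by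
    rw [← ENNReal.ofReal_natCast, ← ENNReal.ofReal_mul (by positivity),
      one_div_mul_cancel hN'.ne', ENNReal.ofReal_one]
  have hbar : Measurable fun ω => ENNReal.ofReal (1 / (N : ℝ)) *
      ∑ i, W (θ i ω) fun j => ξ i j ω :=
    (Finset.measurable_sum _ fun i _ => hrow i).const_mul _
  obtain ⟨G, hG, hGp, hGle⟩ := exists_measurableSet_of_lintegral_exp_le (Pr := Pr) hbar
    (a := 7 * (finrank ℝ E + 1) + 32 * (M * τ / (64 * R ^ 2)) ^ 2 * R ^ 2 / M)
    (c := M * τ / (64 * R ^ 2) * τ) (p := p) (by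
      rw [lintegral_const_mul _ (Finset.measurable_sum _ fun i _ => hrow i),
        lintegral_finsetSum _ fun i _ => hrow i]
      calc _ ≤ ENNReal.ofReal (1 / (N : ℝ)) * ∑ _i : Fin N, ENNReal.ofReal (Real.exp
            (7 * (finrank ℝ E + 1) + 32 * (M * τ / (64 * R ^ 2)) ^ 2 * R ^ 2 / M)) := by
            gcongr with i
            rw [h.lintegral_row i hW]
            refine (lintegral_mono hWint).trans ?_
            rw [lintegral_const, measure_univ, mul_one]
        _ = _ := by
            rw [Finset.sum_const, Finset.card_univ, Fintype.card_fin, nsmul_eq_mul, ← mul_assoc,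
              hone, one_mul]) hp (tail_exponent_le hM' hR hτ hMp)
  refine ⟨G, hG, hGp, fun ω hω a ha w => ?_⟩
  have key := hGle ω hω (M * τ / (64 * R ^ 2) * ((1 / (N : ℝ)) * ∑ i,
    |empDev (P (θ i ω)) (fun y => max (F a y - w i) 0) (fun j => ξ i j ω)|)) (by
      rw [mul_left_comm, Finset.mul_sum]
      -- Jensen replaces a union bound over rows, so the required M does not grow with N;
      -- independence between rows plays no role here.
      refine (ENNReal.ofReal_le_ofReal (exp_average_le hN _)).trans ?_
      rw [ENNReal.ofReal_mul (by positivity),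
        ENNReal.ofReal_sum_of_nonneg fun i _ => (Real.exp_pos _).le]
      gcongr with i
      exact hWle _ _ a ha _)
  exact le_of_mul_le_mul_left key hlam

end Tails

/-! ### From small deviations to close optimal values. -/

section Values

open Set

variable {E X Θ : Type*} [MeasurableSpace X] [MeasurableSpace Θ] {μ : Measure Θ}
  [IsProbabilityMeasure μ] {P : Kernel Θ X} [IsMarkovKernel P] {A : Set E} {F : E → X → ℝ}
  {α β B : ℝ} {N M : ℕ}

/-- Because 1/β and 1/α exceed 1 and positive parts are nonnegative, each level dominates a plain
average. This lower bound is what makes the infimum genuine. -/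
theorem neg_le_add_average_of_feasible (hα : α ∈ Ioo (0 : ℝ) 1) (hβ : β ∈ Ioo (0 : ℝ) 1)
    (hN : 0 < N) (hM : 0 < M) {y : Fin N → Fin M → ℝ} (hy : ∀ i j, |y i j| ≤ B) {u : ℝ}
    {v w : Fin N → ℝ} (hv : ∀ i, w i + (1 / (β * M)) * ∑ j, max (y i j - w i) 0 - u ≤ v i)
    (hv0 : ∀ i, 0 ≤ v i) : -B ≤ u + (1 / (α * N)) * ∑ i, v i := by
  have hN' : (0 : ℝ) < N := by exact_mod_cast hN
  have hM' : (0 : ℝ) < M := by exact_mod_cast hM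
  have hrow : ∀ i, -B - u ≤ v i := by
    intro i
    have h0 : 0 ≤ ∑ j, max (y i j - w i) 0 := Finset.sum_nonneg fun j _ => le_max_right _ _
    have h1 : ∑ _j : Fin M, (-B - w i) ≤ ∑ j, max (y i j - w i) 0 :=
      Finset.sum_le_sum fun j _ => le_max_of_le_left (by linarith [(abs_le.1 (hy i j)).1])
    simp only [Finset.sum_const, Finset.card_univ, Fintype.card_fin, nsmul_eq_mul] at h1
    have h2 : 1 / (M : ℝ) ≤ 1 / (β * M) :=
      one_div_le_one_div_of_le (mul_pos hβ.1 hM') (mul_le_of_le_one_left hM'.le hβ.2.le)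
    have h3 := mul_le_mul_of_nonneg_right h2 h0
    have h4 := mul_le_mul_of_nonneg_left h1 (one_div_nonneg.2 hM'.le)
    rw [← mul_assoc, one_div_mul_cancel hM'.ne', one_mul] at h4
    linarith [hv i]
  have h0 : 0 ≤ ∑ i, v i := Finset.sum_nonneg fun i _ => hv0 i
  have h1 : ∑ _i : Fin N, (-B - u) ≤ ∑ i, v i := Finset.sum_le_sum fun i _ => hrow i
  simp only [Finset.sum_const, Finset.card_univ, Fintype.card_fin, nsmul_eq_mul] at h1
  have h2 : 1 / (N : ℝ) ≤ 1 / (α * N) :=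
    one_div_le_one_div_of_le (mul_pos hα.1 hN') (mul_le_of_le_one_left hN'.le hα.2.le)
  have h3 := mul_le_mul_of_nonneg_right h2 h0
  have h4 := mul_le_mul_of_nonneg_left h1 (one_div_nonneg.2 hN'.le)
  rw [← mul_assoc, one_div_mul_cancel hN'.ne', one_mul] at h4
  linarith

theorem neg_le_of_mem_trueValue (hα : α ∈ Ioo (0 : ℝ) 1) {Y : Θ → ℝ} (hY : Measurable Y)
    (hYB : ∀ t, |Y t| ≤ B) (u : ℝ) : -B ≤ u + (1 / α) * ∫ t, max (Y t - u) 0 ∂μ := by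
  have h0 : 0 ≤ ∫ t, max (Y t - u) 0 ∂μ := integral_nonneg fun t => le_max_right _ _
  have h1 : ∫ _, (-B - u) ∂μ ≤ ∫ t, max (Y t - u) 0 ∂μ :=
    integral_mono (integrable_const _) (integrable_posPart_sub hY hYB _)
      fun t => le_max_of_le_left (by linarith [(abs_le.1 (hYB t)).1])
  rw [integral_const, probReal_univ, one_smul] at h1
  have h2 : (1 : ℝ) ≤ 1 / α := by rw [le_div_iff₀ hα.1]; linarith [hα.2]
  have := mul_le_mul_of_nonneg_right h2 h0
  linarith

theorem abs_nestedSAAValue_le {E X : Type*} {A : Set E} {F : E → X → ℝ} {α β B : ℝ} {N M : ℕ}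
    (hAne : A.Nonempty) (hα : α ∈ Ioo (0 : ℝ) 1)
    (hβ : β ∈ Ioo (0 : ℝ) 1) (hFB : ∀ a ∈ A, ∀ x, |F a x| ≤ B) (hN : 0 < N) (hM : 0 < M)
    (x : Fin N → Fin M → X) : |nestedSAAValue α β A F x| ≤ B := by
  obtain ⟨a₀, ha₀⟩ := hAne
  have hmem : B ∈ {r : ℝ | ∃ u : ℝ, ∃ a ∈ A, ∃ v w : Fin N → ℝ,
      (∀ i, w i + (1 / (β * M)) * ∑ j, max (F a (x i j) - w i) 0 - u ≤ v i) ∧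
      (∀ i, 0 ≤ v i) ∧ r = u + (1 / (α * N)) * ∑ i, v i} := by
    refine ⟨B, a₀, ha₀, fun _ => 0, fun _ => B, fun i => ?_, fun i => le_rfl, by simp⟩
    have : ∀ j, max (F a₀ (x i j) - B) 0 = 0 := fun j =>
      max_eq_right (by linarith [(abs_le.1 (hFB a₀ ha₀ (x i j))).2])
    simp [this]
  have hlb : ∀ r ∈ {r : ℝ | ∃ u : ℝ, ∃ a ∈ A, ∃ v w : Fin N → ℝ,
      (∀ i, w i + (1 / (β * M)) * ∑ j, max (F a (x i j) - w i) 0 - u ≤ v i) ∧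
      (∀ i, 0 ≤ v i) ∧ r = u + (1 / (α * N)) * ∑ i, v i}, -B ≤ r := by
    rintro r ⟨u, a, ha, v, w, hv, hv0, rfl⟩
    exact neg_le_add_average_of_feasible hα hβ hN hM (fun i j => hFB a ha (x i j)) hv hv0
  exact abs_le.2 ⟨le_csInf ⟨B, hmem⟩ hlb, csInf_le ⟨-B, hlb⟩ hmem⟩

theorem abs_trueValue_le (hAne : A.Nonempty) (hα : α ∈ Ioo (0 : ℝ) 1) (hβ : β ∈ Ioo (0 : ℝ) 1)
    (hF : ∀ a ∈ A, Measurable (F a)) (hFB : ∀ a ∈ A, ∀ x, |F a x| ≤ B) :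
    |trueValue α β A F μ P| ≤ B := by
  obtain ⟨a₀, ha₀⟩ := hAne
  have hmem : B ∈ {r : ℝ | ∃ a ∈ A, ∃ u : ℝ,
      r = u + (1 / α) * ∫ θ, max (AVaR β (P θ) (F a) - u) 0 ∂μ} := by
    refine ⟨a₀, ha₀, B, ?_⟩
    have : ∀ t, max (AVaR β (P t) (F a₀) - B) 0 = 0 := fun t => max_eq_right
      (by linarith [(abs_le.1 (abs_AVaR_le (P := P t) hβ (hF a₀ ha₀) (hFB a₀ ha₀))).2])
    simp [this]
  have hlb : ∀ r ∈ {r : ℝ | ∃ a ∈ A, ∃ u : ℝ,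
      r = u + (1 / α) * ∫ θ, max (AVaR β (P θ) (F a) - u) 0 ∂μ}, -B ≤ r := by
    rintro r ⟨a, ha, u, rfl⟩
    exact neg_le_of_mem_trueValue hα (measurable_AVaR P hβ (hF a ha) (hFB a ha))
      (fun t => abs_AVaR_le hβ (hF a ha) (hFB a ha)) u
  exact abs_le.2 ⟨le_csInf ⟨B, hmem⟩ hlb, csInf_le ⟨-B, hlb⟩ hmem⟩

/-- An exact identity: a row of the sample constraint is the true Rockafellar-Uryasev objective plus
1/β times an inner deviation. -/
theorem ruObjective_add_empDev (hβ : β ∈ Ioo (0 : ℝ) 1) (hM : 0 < M) (ν : Measure X) (f : X → ℝ)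
    (w : ℝ) (x : Fin M → X) :
    w + (1 / (β * M)) * ∑ j, max (f (x j) - w) 0 =
      ruObjective β ν f w + (1 / β) * empDev ν (fun y => max (f y - w) 0) x := by
  have hM' : (M : ℝ) ≠ 0 := by exact_mod_cast hM.ne'
  have hβ' := hβ.1.ne'
  rw [ruObjective, empDev]
  field_simp
  ring

/-- The optimal value of the nested sample average approximation is close to the true value as soon
as the empirical deviations of the inner and of the outer level are small. -/
theorem abs_nestedSAAValue_sub_trueValue_le (hAne : A.Nonempty) (hα : α ∈ Ioo (0 : ℝ) 1)
    (hβ : β ∈ Ioo (0 : ℝ) 1) (hF : ∀ a ∈ A, Measurable (F a)) (hFB : ∀ a ∈ A, ∀ x, |F a x| ≤ B)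
    (hN : 0 < N) (hM : 0 < M) {t : Fin N → Θ} {x : Fin N → Fin M → X} {δ κ : ℝ}
    (hin : ∀ a ∈ A, ∀ w : Fin N → ℝ, (1 / (N : ℝ)) *
      ∑ i, |empDev (P (t i)) (fun y => max (F a y - w i) 0) (x i)| ≤ α * β * δ)
    (hout : ∀ a ∈ A, ∀ u : ℝ,
      |empDev μ (fun s => max (AVaR β (P s) (F a) - u) 0) t| ≤ α * κ) :
    |nestedSAAValue α β A F x - trueValue α β A F μ P| ≤ δ + κ := by
  have hN' : (0 : ℝ) < N := by exact_mod_cast hN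
  have hα0 := hα.1
  have hβ0 := hβ.1
  obtain ⟨a₀, ha₀⟩ := hAne
  have hsplit : ∀ s : ℝ, 1 / (α * N) * s = 1 / α * (1 / N * s) := fun s => by
    rw [← mul_assoc, one_div_mul_one_div]
  have hin' : ∀ a ∈ A, ∀ w : Fin N → ℝ, 1 / α * (1 / N * ∑ i, 1 / β *
      |empDev (P (t i)) (fun y => max (F a y - w i) 0) (x i)|) ≤ δ := by
    intro a ha w
    rw [← Finset.mul_sum]
    have := mul_le_mul_of_nonneg_left (hin a ha w)
      (by positivity : 0 ≤ 1 / α * (1 / β))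
    calc _ = 1 / α * (1 / β) * (1 / N * ∑ i,
          |empDev (P (t i)) (fun y => max (F a y - w i) 0) (x i)|) := by ring
      _ ≤ _ := this
      _ = δ := by field_simp
  have hout' : ∀ a ∈ A, ∀ u : ℝ,
      |1 / α * (1 / N * ∑ i, max (AVaR β (P (t i)) (F a) - u) 0)
        - 1 / α * ∫ s, max (AVaR β (P s) (F a) - u) 0 ∂μ| ≤ κ := by
    intro a ha u
    rw [← mul_sub, abs_mul, abs_of_pos (one_div_pos.2 hα0), one_div, inv_mul_le_iff₀ hα0]
    exact hout a ha u
  have hmono : ∀ p q : Fin N → ℝ, (∀ i, p i ≤ q i) →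
      1 / α * (1 / N * ∑ i, p i) ≤ 1 / α * (1 / N * ∑ i, q i) := fun p q hpq =>
    mul_le_mul_of_nonneg_left (mul_le_mul_of_nonneg_left
      (Finset.sum_le_sum fun i _ => hpq i) (by positivity)) (by positivity)
  rw [abs_sub_le_iff]
  constructor
  · rw [sub_le_comm]
    refine le_csInf ⟨_, a₀, ha₀, 0, rfl⟩ ?_
    rintro r ⟨a, ha, u, rfl⟩
    choose w hwB hw using fun i =>
      exists_ruObjective_eq_AVaR (P := P (t i)) hβ (hF a ha) (hFB a ha)
    set e : Fin N → ℝ := fun i => |empDev (P (t i)) (fun y => max (F a y - w i) 0) (x i)| with he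
    -- Trial point: w_i is the minimiser for P_{θ_i}, and v_i is the true excess enlarged by the
    -- inner deviation, which makes it feasible.
    have hbdd : nestedSAAValue α β A F x ≤ u + 1 / (α * N) *
        ∑ i, (max (AVaR β (P (t i)) (F a) - u) 0 + 1 / β * e i) := by
      refine csInf_le ⟨-B, ?_⟩ ⟨u, a, ha, _, w, fun i => ?_, fun i => ?_, rfl⟩
      · rintro r ⟨u, a, ha, v, w, hv, hv0, rfl⟩
        exact neg_le_add_average_of_feasible hα hβ hN hM (fun i j => hFB a ha (x i j)) hv hv0
      · rw [ruObjective_add_empDev hβ hM (P (t i)), hw i]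
        have h1 := mul_le_mul_of_nonneg_left
          (le_abs_self (empDev (P (t i)) (fun y => max (F a y - w i) 0) (x i)))
          (one_div_nonneg.2 hβ0.le)
        have h2 := le_max_left (AVaR β (P (t i)) (F a) - u) 0
        simp only [he]
        linarith
      · exact add_nonneg (le_max_right _ _) (mul_nonneg (by positivity) (abs_nonneg _))
    rw [hsplit, Finset.sum_add_distrib, mul_add, mul_add] at hbdd
    linarith [hin' a ha w, (abs_le.1 (hout' a ha u)).2]
  · rw [sub_le_comm]
    refine le_csInf ⟨_, 0, a₀, ha₀, _, 0, fun i => le_max_left _ 0, fun i => le_max_right _ _,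
      rfl⟩ ?_
    rintro r ⟨u, a, ha, v, w, hv, hv0, rfl⟩
    have hT : trueValue α β A F μ P ≤ u + 1 / α * ∫ s, max (AVaR β (P s) (F a) - u) 0 ∂μ := by
      refine csInf_le ⟨-B, ?_⟩ ⟨a, ha, u, rfl⟩
      rintro r ⟨a, ha, u, rfl⟩
      exact neg_le_of_mem_trueValue hα (measurable_AVaR P hβ (hF a ha) (hFB a ha))
        (fun t => abs_AVaR_le hβ (hF a ha) (hFB a ha)) u
    -- Conversely, AVaR lies below the objective at any w_i, so each feasible v_i bounds the true
    -- excess up to the inner deviation.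
    have hrow : ∀ i, max (AVaR β (P (t i)) (F a) - u) 0 ≤
        v i + 1 / β * |empDev (P (t i)) (fun y => max (F a y - w i) 0) (x i)| := by
      intro i
      have h1 := AVaR_le_ruObjective (P := P (t i)) hβ (hF a ha) (hFB a ha) (w i)
      have h2 := hv i
      rw [ruObjective_add_empDev hβ hM (P (t i))] at h2
      have h3 := mul_le_mul_of_nonneg_left
        (neg_abs_le (empDev (P (t i)) (fun y => max (F a y - w i) 0) (x i)))
        (one_div_nonneg.2 hβ0.le)
      refine max_le (by linarith) (add_nonneg (hv0 i) (mul_nonneg (by positivity) (abs_nonneg _)))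
    have h4 := hmono _ _ hrow
    rw [Finset.sum_add_distrib, mul_add, mul_add] at h4
    rw [hsplit]
    linarith [hin' a ha w, (abs_le.1 (hout' a ha u)).1]

end Values

/-! ### Assembly of the events and choice of the constants. -/

section Main

open Module in
/-- High-probability closeness of the nested sample average approximation, in terms of sample sizes
without a logarithmic dependence on the accuracies. -/
theorem one_sub_sub_le_probReal_abs_sub_le {E Ω X Θ : Type*} [NormedAddCommGroup E]
    [NormedSpace ℝ E] [FiniteDimensional ℝ E] [MeasurableSpace Ω] [MeasurableSpace X]
    [MeasurableSpace Θ] {Pr : Measure Ω} [IsProbabilityMeasure Pr] {μ : Measure Θ}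
    [IsProbabilityMeasure μ] {P : Kernel Θ X} [IsMarkovKernel P] {N M : ℕ} {θ : Fin N → Ω → Θ}
    {ξ : Fin N → Fin M → Ω → X} {A : Set E} {F : E → X → ℝ} {α β B L D δ κ p p' : ℝ}
    (h : IsNestedSample Pr μ P θ ξ) (hAne : A.Nonempty) (hα : α ∈ Set.Ioo (0 : ℝ) 1)
    (hβ : β ∈ Set.Ioo (0 : ℝ) 1) (hB : 0 < B) (hL : 0 < L) (hD : 0 < D) (hAD : ∀ a ∈ A, ‖a‖ ≤ D)
    (hF : ∀ a ∈ A, Measurable (F a)) (hFB : ∀ a ∈ A, ∀ x, |F a x| ≤ B)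
    (hLip : ∀ a₁ ∈ A, ∀ a₂ ∈ A, ∀ x, |F a₁ x - F a₂ x| ≤ L * ‖a₁ - a₂‖)
    (hN : 0 < N) (hM : 0 < M) (hδ : 0 < δ) (hκ : 0 < κ) (hp : 0 < p) (hp' : 0 < p')
    (hNp : 128 * (4 * (B + L * D)) ^ 2 / (α * κ) ^ 2 *
      (7 * (finrank ℝ E + 1) + Real.log (1 / p)) ≤ N)
    (hMp : 128 * (4 * (B + L * D)) ^ 2 / (α * β * δ) ^ 2 *
      (7 * (finrank ℝ E + 1) + Real.log (1 / p')) ≤ M) :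
    1 - p - 2 * p' ≤ Pr.real {ω |
      nestedSAAValue α β A F (fun i j => ξ i j ω) - δ - κ ≤ trueValue α β A F μ P ∧
      trueValue α β A F μ P ≤ nestedSAAValue α β A F (fun i j => ξ i j ω) + δ + κ} := by
  obtain ⟨G₁, hG₁, hp₁, hin⟩ := h.exists_inner_event hAne hB hL hD hAD hF hFB hLip hN hM
    (mul_pos (mul_pos hα.1 hβ.1) hδ) hp' hMp
  obtain ⟨G₂, hG₂, hp₂, hout⟩ := h.exists_outer_event hAne
    (Y := fun a t => AVaR β (P t) (F a)) hB hL hD hAD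
    (fun a ha => measurable_AVaR P hβ (hF a ha) (hFB a ha))
    (fun a ha t => abs_AVaR_le hβ (hF a ha) (hFB a ha))
    (fun a ha a' ha' t => abs_AVaR_sub_le hβ (hF a ha) (hFB a ha) (hF a' ha') (hFB a' ha')
      (hLip a ha a' ha'))
    hN (mul_pos hα.1 hκ) hp hNp
  have hsub : G₁ ∩ G₂ ⊆ {ω |
      nestedSAAValue α β A F (fun i j => ξ i j ω) - δ - κ ≤ trueValue α β A F μ P ∧
      trueValue α β A F μ P ≤ nestedSAAValue α β A F (fun i j => ξ i j ω) + δ + κ} := by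
    rintro ω ⟨h1, h2⟩
    have := abs_le.1 (abs_nestedSAAValue_sub_trueValue_le hAne hα hβ hF hFB hN hM
      (hin ω h1) (hout ω h2))
    exact ⟨by linarith [this.2], by linarith [this.1]⟩
  refine le_trans ?_ (measureReal_mono hsub)
  have hcompl : Pr.real (G₁ ∩ G₂)ᶜ ≤ p' + p := by
    rw [Set.compl_inter]
    refine (measureReal_union_le _ _).trans (add_le_add ?_ ?_)
    · exact ENNReal.toReal_le_of_le_ofReal hp'.le hp₁
    · exact ENNReal.toReal_le_of_le_ofReal hp.le hp₂
  rw [probReal_compl_eq_one_sub (hG₁.inter hG₂)] at hcompl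
  linarith

/-- Here KLD/η = 50R/(αLη) + 6B/(Lη). The square of the first term supplies the coefficient, since
14·128 = 1792 ≤ 2500. The second exceeds 3 when Lη < 2B, so the logarithm is at least 1 and 7(n+1) ≤
14n log(KLD/η). -/
theorem outer_size_le {α B L D η ε : ℝ} {n : ℕ} (hα : 0 < α) (hL : 0 < L) (hD : 0 < D)
    (hB : 0 < B) (hη : 0 < η) (hε : 0 < ε) (hε1 : ε < 1) (hn : 1 ≤ n) (hsmall : L * η < 2 * B) :
    128 * (4 * (B + L * D)) ^ 2 / (α * (L * η)) ^ 2 * (7 * (n + 1) + Real.log (1 / ε)) ≤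
      outerSampleSize ((50 * (4 * (B + L * D)) / (α * L) + 6 * B / L) / (L * D)) L D η ε n := by
  have hLD : 0 < L * D := mul_pos hL hD
  set R := 4 * (B + L * D) with hR
  have hR0 : 0 < R := by positivity
  have hn' : (1 : ℝ) ≤ n := by exact_mod_cast hn
  have hlogε : 0 ≤ Real.log (1 / ε) := Real.log_nonneg (by rw [le_div_iff₀ hε]; linarith)
  have hKLD : (50 * R / (α * L) + 6 * B / L) / (L * D) * L * D / η
      = 50 * R / (α * L * η) + 6 * B / (L * η) := by
    field_simp
  rw [outerSampleSize, hKLD]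
  set q := 50 * R / (α * L * η) with hq
  have hq0 : 0 < q := by positivity
  have h3 : 3 ≤ 6 * B / (L * η) := by
    rw [le_div_iff₀ (mul_pos hL hη)]
    linarith
  have hlog : 1 ≤ Real.log (q + 6 * B / (L * η)) := by
    rw [Real.le_log_iff_exp_le (by linarith)]
    linarith [Real.exp_one_lt_d9]
  have hsq : 14 * (128 * R ^ 2 / (α * (L * η)) ^ 2) ≤ (q + 6 * B / (L * η)) ^ 2 := by
    calc 14 * (128 * R ^ 2 / (α * (L * η)) ^ 2) = 1792 / 2500 * q ^ 2 := by
          rw [hq]; field_simp; norm_num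
      _ ≤ q ^ 2 := by linarith [sq_nonneg q]
      _ ≤ _ := pow_le_pow_left₀ hq0.le (by linarith) 2
  have hn1 : (n : ℝ) ≤ n * Real.log (q + 6 * B / (L * η)) :=
    le_mul_of_one_le_right (by linarith) hlog
  have hc0 : 0 ≤ 128 * R ^ 2 / (α * (L * η)) ^ 2 := by positivity
  calc 128 * R ^ 2 / (α * (L * η)) ^ 2 * (7 * (n + 1) + Real.log (1 / ε))
      ≤ 128 * R ^ 2 / (α * (L * η)) ^ 2 *
        (14 * (n * Real.log (q + 6 * B / (L * η)) + Real.log (1 / ε))) :=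
        mul_le_mul_of_nonneg_left (by linarith) hc0
    _ = 14 * (128 * R ^ 2 / (α * (L * η)) ^ 2) *
        (n * Real.log (q + 6 * B / (L * η)) + Real.log (1 / ε)) := by ring
    _ ≤ _ := mul_le_mul_of_nonneg_right hsq (by linarith)

/-- υ is so small that D/υ and 2B/υ are both at least e^7. The n + 1 factors inside the logarithm
then give 7(n+1), although υ is independent of n. -/
theorem inner_size_le {α β γ Cbar R D δ ε' : ℝ} {n : ℕ} (hR : 0 < R)
    (hD : 0 < D) (hC : 0 < Cbar) (hγ : γ < 1) :
    128 * R ^ 2 / (α * β * δ) ^ 2 * (7 * (n + 1) + Real.log (1 / ε')) ≤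
      innerSampleSize (4 * R / (α * β)) (Real.exp 7 * (1 / D + 1 / (2 * (Cbar / (1 - γ)))))⁻¹
        D Cbar γ δ ε' n := by
  have hγ' : 0 < 1 - γ := by linarith
  have hB : 0 < Cbar / (1 - γ) := div_pos hC hγ'
  set B := Cbar / (1 - γ) with hBdef
  set y := Real.exp 7 * (1 / D + 1 / (2 * B)) with hy
  have hy0 : 0 < y := by positivity
  have hDy : Real.exp 7 ≤ D * y := by
    have : D * y = Real.exp 7 + Real.exp 7 * (D / (2 * B)) := by rw [hy]; field_simp
    rw [this]
    linarith [(by positivity : 0 ≤ Real.exp 7 * (D / (2 * B)))]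
  have hBy : Real.exp 7 ≤ 2 * B * y := by
    have : 2 * B * y = Real.exp 7 + Real.exp 7 * (2 * B / D) := by rw [hy]; field_simp; ring
    rw [this]
    linarith [(by positivity : 0 ≤ Real.exp 7 * (2 * B / D))]
  have hval : D ^ n * (2 * Cbar) / (y⁻¹ ^ (n + 1) * (1 - γ)) = (D * y) ^ n * (2 * B * y) := by
    clear_value y
    rw [hBdef, inv_pow, mul_pow, pow_succ]
    field_simp
  have hlog : 7 * (n + 1 : ℝ) ≤ Real.log (1 + D ^ n * (2 * Cbar) / (y⁻¹ ^ (n + 1) * (1 - γ))) := by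
    rw [hval, Real.le_log_iff_exp_le (by positivity)]
    have h1 : Real.exp (7 * (n + 1)) = Real.exp 7 ^ n * Real.exp 7 := by
      rw [← Real.exp_nat_mul, ← Real.exp_add]; ring_nf
    rw [h1]
    have := mul_le_mul (pow_le_pow_left₀ (Real.exp_pos 7).le hDy n) hBy (Real.exp_pos 7).le
      (by positivity)
    linarith
  rw [innerSampleSize]
  have hcoef : 8 * (4 * R / (α * β)) ^ 2 / δ ^ 2 = 128 * R ^ 2 / (α * β * δ) ^ 2 := by
    rw [div_pow, mul_pow, mul_pow (α * β), mul_div_assoc', div_div]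
    ring_nf
  rw [hcoef]
  exact mul_le_mul_of_nonneg_left (by linarith) (by positivity)

theorem exists_sampleSize_constants {α β γ L D Cbar : ℝ} (hα : 0 < α) (hβ : 0 < β) (hL : 0 < L)
    (hD : 0 < D) (hCbar : 0 ≤ Cbar) (hγ : γ < 1) :
    ∃ K σ υ : ℝ, 0 < K ∧ 0 < σ ∧ 0 < υ ∧ ∀ n : ℕ, 1 ≤ n → ∀ η ε δ ε' : ℝ, 0 < η → 0 < ε → ε < 1 →
      0 < Cbar → L * η < 2 * (Cbar / (1 - γ)) →
      128 * (4 * (Cbar / (1 - γ) + L * D)) ^ 2 / (α * (L * η)) ^ 2 *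
        (7 * (Module.finrank ℝ (EuclideanSpace ℝ (Fin n)) + 1) + Real.log (1 / ε))
        ≤ outerSampleSize K L D η ε n ∧
      128 * (4 * (Cbar / (1 - γ) + L * D)) ^ 2 / (α * β * δ) ^ 2 *
        (7 * (Module.finrank ℝ (EuclideanSpace ℝ (Fin n)) + 1) + Real.log (1 / ε'))
        ≤ innerSampleSize σ υ D Cbar γ δ ε' n := by
  have hγ' : 0 < 1 - γ := by linarith
  have hLD : 0 < L * D := mul_pos hL hD
  -- The constants stay positive for C̄ = 0, where 1/(2·0) is read as 0; the size estimates are only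
  -- claimed for C̄ > 0.
  refine ⟨(50 * (4 * (Cbar / (1 - γ) + L * D)) / (α * L) + 6 * (Cbar / (1 - γ)) / L) / (L * D),
    4 * (4 * (Cbar / (1 - γ) + L * D)) / (α * β),
    (Real.exp 7 * (1 / D + 1 / (2 * (Cbar / (1 - γ)))))⁻¹, by positivity, by positivity,
    by positivity, ?_⟩
  intro n hn η ε δ ε' hη hε hε1 hC hsmall
  rw [finrank_euclideanSpace_fin]
  have hB : 0 < Cbar / (1 - γ) := div_pos hC hγ'
  exact ⟨outer_size_le hα hL hD hB hη hε hε1 hn hsmall,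
    inner_size_le (by positivity) hD hC hγ⟩

theorem abs_stageCost_le {n k : ℕ} {S Ξ Θ : Type*} [MeasurableSpace Θ] {γ Cbar : ℝ}
    (hγ : γ ∈ Set.Ioo (0 : ℝ) 1)
    {C : S → EuclideanSpace ℝ (Fin n) → Ξ → ℝ} {g : S → EuclideanSpace ℝ (Fin n) → Ξ → S}
    {belief : EuclideanSpace ℝ (Fin k) → ProbabilityMeasure Θ} {H : Ξ → EuclideanSpace ℝ (Fin k)}
    {grid : Finset (EuclideanSpace ℝ (Fin k))}
    {Rep : EuclideanSpace ℝ (Fin k) → EuclideanSpace ℝ (Fin k)} {V : S → ProbabilityMeasure Θ → ℝ}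
    {h : EuclideanSpace ℝ (Fin k)} {s : S} {a : EuclideanSpace ℝ (Fin n)}
    (hC : ∀ x, |C s a x| ≤ Cbar) (hV : ∀ s', ∀ y ∈ grid, |V s' (belief y)| ≤ Cbar / (1 - γ))
    (hRep : IsNearestPointMap grid Rep) (x : Ξ) :
    |stageCost γ C g belief H Rep V h s a x| ≤ Cbar / (1 - γ) := by
  have hγ' : 0 < 1 - γ := by linarith [hγ.2]
  have h1 := hV (g s a x) _ (hRep (h + H x)).1
  have h2 : |γ * V (g s a x) (belief (Rep (h + H x)))| ≤ γ * (Cbar / (1 - γ)) := by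
    rw [abs_mul, abs_of_pos hγ.1]
    exact mul_le_mul_of_nonneg_left h1 hγ.1.le
  have h3 : Cbar + γ * (Cbar / (1 - γ)) = Cbar / (1 - γ) := by field_simp; ring
  rw [← h3, stageCost]
  exact (abs_add_le _ _).trans (add_le_add (hC x) h2)

end Main

theorem mainTheorem12
    (α β γ L D Cbar : ℝ)
    (hα : α ∈ Set.Ioo (0 : ℝ) 1) (hβ : β ∈ Set.Ioo (0 : ℝ) 1) (hγ : γ ∈ Set.Ioo (0 : ℝ) 1)
    (hL : 0 < L) (hD : 0 < D) (hCbar : 0 ≤ Cbar) :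
    ∃ K σ υ : ℝ, 0 < K ∧ 0 < σ ∧ 0 < υ ∧
      ∀ (n k : ℕ) (_ : 1 ≤ n)
        (S Ξ Θ : Type*) [MeasurableSpace Ξ] [MeasurableSpace Θ]
        -- the action set
        (A : Set (EuclideanSpace ℝ (Fin n))) (_ : IsCompact A) (_ : A.Nonempty)
        (_ : ∀ a ∈ A, ‖a‖ ≤ D)
        -- cost, transition map, parametric family, beliefs, statistic, grid and value function
        (C : S → EuclideanSpace ℝ (Fin n) → Ξ → ℝ)
        (g : S → EuclideanSpace ℝ (Fin n) → Ξ → S)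
        (P : Kernel Θ Ξ) [IsMarkovKernel P]
        (belief : EuclideanSpace ℝ (Fin k) → ProbabilityMeasure Θ)
        (H : Ξ → EuclideanSpace ℝ (Fin k))
        (grid : Finset (EuclideanSpace ℝ (Fin k)))
        (Rep : EuclideanSpace ℝ (Fin k) → EuclideanSpace ℝ (Fin k))
        (_ : IsNearestPointMap grid Rep)
        (V : S → ProbabilityMeasure Θ → ℝ)
        (h : EuclideanSpace ℝ (Fin k))
        -- boundedness and measurability
        (_ : ∀ s, ∀ a ∈ A, ∀ ξ, |C s a ξ| ≤ Cbar)
        (_ : ∀ s, ∀ y ∈ grid, |V s (belief y)| ≤ Cbar / (1 - γ))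
        (_ : ∀ s, ∀ a ∈ A, Measurable (stageCost γ C g belief H Rep V h s a))
        -- Lipschitz continuity in the action, with modulus `L`
        (_ : ∀ s, ∀ a₁ ∈ A, ∀ a₂ ∈ A, ∀ ξ,
          |stageCost γ C g belief H Rep V h s a₁ ξ - stageCost γ C g belief H Rep V h s a₂ ξ|
            ≤ L * ‖a₁ - a₂‖)
        -- Lipschitz continuity with a random modulus whose moment generating function is finite
        -- in a neighbourhood of zero
        (φ : Ξ → ℝ) (_ : Measurable φ) (_ : ∀ ξ, 0 ≤ φ ξ)
        (_ : ∀ s, ∀ a₁ ∈ A, ∀ a₂ ∈ A, ∀ ξ,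
          |stageCost γ C g belief H Rep V h s a₁ ξ - stageCost γ C g belief H Rep V h s a₂ ξ|
            ≤ φ ξ * ‖a₁ - a₂‖)
        (_ : ∀ θ, ∃ r > 0, ∀ t : ℝ, |t| < r → Integrable (fun ξ => Real.exp (t * φ ξ)) (P θ))
        -- accuracies, confidence levels and sample sizes
        (η ε δ ε' : ℝ) (_ : 0 < η) (_ : 0 < ε) (_ : 0 < δ) (_ : ε' ∈ Set.Ioo (0 : ℝ) 1)
        (N M : ℕ) (_ : 0 < N) (_ : 0 < M)
        (_ : outerSampleSize K L D η ε n ≤ N)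
        (_ : innerSampleSize σ υ D Cbar γ δ ε' n ≤ M)
        -- the random samples
        (Ω : Type*) [MeasurableSpace Ω] (Pr : Measure Ω) [IsProbabilityMeasure Pr]
        (θ : Fin N → Ω → Θ) (ξ : Fin N → Fin M → Ω → Ξ)
        (_ : IsNestedSample Pr (belief h : Measure Θ) P θ ξ)
        (s : S),
        let F := stageCost γ C g belief H Rep V h s
        let trueVal := trueValue α β A F (belief h : Measure Θ) P
        let saaVal := fun ω => nestedSAAValue α β A F (fun i j => ξ i j ω)
        1 - ε - 2 * ε' ≤
          Pr.real {ω | saaVal ω - δ - L * η ≤ trueVal ∧ trueVal ≤ saaVal ω + δ + L * η} := by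
  obtain ⟨K, σ, υ, hK, hσ, hυ, hsizes⟩ := exists_sampleSize_constants hα.1 hβ.1 hL hD hCbar hγ.2
  refine ⟨K, σ, υ, hK, hσ, hυ, ?_⟩
  intro n k hn S Ξ Θ _ _ A _ hAne hAD C g P _ belief H grid Rep hRep V h hC hV hmeas hLip
    φ _ _ _ _ η ε δ ε' hη hε hδ hε' N M hN hM hN0 hM0 Ω _ Pr _ θ ξ hsample s F trueVal saaVal
  have hFm : ∀ a ∈ A, Measurable (F a) := hmeas s
  have hFB : ∀ a ∈ A, ∀ x, |F a x| ≤ Cbar / (1 - γ) := fun a ha x =>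
    abs_stageCost_le hγ (hC s a ha) (fun s' => hV s') hRep x
  have hFL : ∀ a₁ ∈ A, ∀ a₂ ∈ A, ∀ x, |F a₁ x - F a₂ x| ≤ L * ‖a₁ - a₂‖ := hLip s
  have hlarge : (∀ ω, |saaVal ω - trueVal| ≤ δ + L * η) → 1 - ε - 2 * ε' ≤
      Pr.real {ω | saaVal ω - δ - L * η ≤ trueVal ∧ trueVal ≤ saaVal ω + δ + L * η} := by
    intro hall
    have hset : {ω | saaVal ω - δ - L * η ≤ trueVal ∧ trueVal ≤ saaVal ω + δ + L * η}
        = Set.univ := by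
      refine Set.eq_univ_of_forall fun ω => ?_
      have := abs_le.1 (hall ω)
      exact ⟨by linarith [this.2], by linarith [this.1]⟩
    rw [hset, probReal_univ]
    linarith [hε'.1]
  -- Both values lie in [-B, B], so tolerances of at least 2B make the event certain. This disposes
  -- of the range of η where the logarithm in N₀ may be small or negative.
  have htriv : ∀ ω, |saaVal ω - trueVal| ≤ 2 * (Cbar / (1 - γ)) := fun ω => by
    have h1 := abs_nestedSAAValue_le hAne hα hβ hFB hN hM fun i j => ξ i j ω
    have h2 := abs_trueValue_le (μ := (belief h : Measure Θ)) (P := P) hAne hα hβ hFm hFB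
    exact (abs_sub _ _).trans (by linarith)
  have hLη : 0 < L * η := mul_pos hL hη
  rcases hCbar.eq_or_lt with hC0 | hCpos
  · refine hlarge fun ω => (htriv ω).trans ?_
    rw [← hC0, zero_div, mul_zero]
    linarith
  rcases le_or_gt (2 * (Cbar / (1 - γ))) (L * η) with hbig | hsmall
  · exact hlarge fun ω => (htriv ω).trans (by linarith)
  rcases le_or_gt 1 ε with hε1 | hε1
  · exact le_trans (by linarith [hε'.1]) measureReal_nonneg
  obtain ⟨hsN, hsM⟩ := hsizes n hn η ε δ ε' hη hε hε1 hCpos hsmall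
  exact one_sub_sub_le_probReal_abs_sub_le hsample hAne hα hβ (div_pos hCpos (by linarith [hγ.2])) hL
    hD hAD hFm hFB hFL hN hM hδ hLη hε hε'.1 (hsN.trans hN0) (hsM.trans hM0)
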